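/- Let $n\in\mathbb N$ and let $D_{ij}=D_{ji}>0$ ($i\neq j$, $1\le i,j\le n$). Let $\mathbf c^0=(c^0_1,\dots,c^0_n)$ be initial data on the torus $\mathbb T^3$ with $0\le c_i^0\in L^\infty(\mathbb T^3)$, $\sum_{i=1}^n c_i^0=1$ and $\int_{\mathbb T^3}\sum_i c_i^0(\ln c_i^0-1)\,dx<\infty$. A function $\mathbf c=(c_1,\dots,c_n)$ on $\mathbb T^3\times(0,\infty)$, with velocities $u_1,\dots,u_n$ and molar fluxes $J_i=c_iu_i$, is called a (nonnegative) *renormalized solution* of the Maxwell–Stefan system $$\partial_t c_i+\nabla\cdot (c_iu_i)=0,\qquad -\sum_{j\ne i}\frac{c_jJ_i-c_iJ_j}{D_{ij}}=\nabla c_i,\qquad \sum_{i=1}^nJ_i=0,\qquad c_i(\cdot,0)=c_i^0,$$ if for every $i\in\{1,\dots,n\}$: (i) $0\le c_i\le 1$ and $\sum_{i=1}^n c_i=1$ almost everywhere; (ii) $\nabla\sqrt{c_i}\in L^2_{\rm loc}(\mathbb T^3\times(0,\infty))$ (weak spatial gradient) and $\sqrt{c_i}\,u_i\in L^2_{\rm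 loc}(\mathbb T^3\times(0,\infty))$; (iii) for all $\phi\in C_c^\infty(\mathbb T^3\times[0,\infty))$ and all $\beta\in C^2([0,\infty))$, $$\int_{\mathbb T^3}\beta(c_i^0)\phi(x,0)\,dx+\int_0^\infty\!\!\int_{\mathbb T^3}\beta(c_i)\,\partial_t\phi\,dx\,dt+\int_0^\infty\!\!\int_{\mathbb T^3}\sqrt{c_i}\,\beta'(c_i)\sqrt{c_i}\,u_i\cdot\nabla\phi\,dx\,dt+2\int_0^\infty\!\!\int_{\mathbb T^3}c_i\,\beta''(c_i)\,\nabla\sqrt{c_i}\cdot\sqrt{c_i}\,u_i\,\phi\,dx\,dt=0,$$ all integrals being absolutely convergent, and the fluxes $J_i=c_iu_i$ satisfy $-\sum_{j\neq i}\frac{c_jJ_i-c_iJ_j}{D_{ij}}=\nabla c_i$ (weak spatial gradient) and $\sum_{i}J_i=0$ almost everywhere; (iv) $\lim_{t\to0}\int_{\mathbb T^3}|\beta(c_i(x,t))-\beta(c_i^0(x))|\,dx=0$ for every $\beta\in C([0,\infty))$ (the limit being taken up to null sets of times, since $c_i$ is determined only almost everywhere). **Theorem.** Let $\mathbf c$ (with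 velocities $u_i$) and $\bar{\mathbf c}$ (with velocities $\bar u_i$) be renormalized solutions of the Maxwell–Stefan system with the same coefficients $D_{ij}$ and the same initial data $\mathbf c^0$. If $c_iu_i\in L^\infty(\mathbb T^3\times(0,\infty))$ and $\bar c_i\bar u_i\in L^\infty(\mathbb T^3\times(0,\infty))$ for all $i$, then $c_i=\bar c_i$ almost everywhere on $\mathbb T^3\times(0,\infty)$ for every $i\in\{1,\dots,n\}$. That is, there is at most one nonnegative renormalized solution with essentially bounded molar fluxes for the given initial data. -/

import Mathlib

open MeasureTheory Set Filter Topology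

noncomputable section

namespace MaxwellStefan

/-- The flat torus `𝕋³ = (ℝ/ℤ)³`, with its Haar (Lebesgue) probability measure `volume`. -/
abbrev Torus3 : Type := UnitAddTorus (Fin 3)

/-- Spatial vectors, with the Euclidean norm and inner product. -/
abbrev E3 : Type := EuclideanSpace ℝ (Fin 3)

/-- The projection `ℝ³ × ℝ → 𝕋³ × ℝ`. -/
def proj (p : (Fin 3 → ℝ) × ℝ) : Torus3 × ℝ := (fun k => (p.1 k : UnitAddCircle), p.2)

/-- Lebesgue measure on `𝕋³ × (0,∞)`, seen as a measure on `𝕋³ × ℝ`. -/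
def stMeasure : Measure (Torus3 × ℝ) :=
  (volume : Measure Torus3).prod ((volume : Measure ℝ).restrict (Ioi 0))

/-- The time slab `𝕋³ × [a,b]`. Every compact subset of `𝕋³ × (0,∞)` lies in a slab
with `0 < a < b`. -/
def slab (a b : ℝ) : Set (Torus3 × ℝ) := univ ×ˢ Icc a b

/-- `f ∈ L^p_loc(𝕋³ × (0,∞))`. -/
def MemLpLoc {F : Type*} [NormedAddCommGroup F] (f : Torus3 × ℝ → F) (p : ENNReal) : Prop :=
  ∀ a b : ℝ, 0 < a → a < b → MemLp f p (stMeasure.restrict (slab a b))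

/-- `φ ∈ C_c^∞(𝕋³ × ℝ)`: compactly supported, with smooth lift to `ℝ³ × ℝ`. The restrictions
of these functions to `𝕋³ × [0,∞)` are exactly the elements of `C_c^∞(𝕋³ × [0,∞))`; they need
not vanish at `t = 0`. -/
structure IsTest (φ : Torus3 × ℝ → ℝ) : Prop where
  smooth : ContDiff ℝ ((⊤ : ℕ∞) : WithTop ℕ∞) (fun p : (Fin 3 → ℝ) × ℝ => φ (proj p))
  compactSupp : HasCompactSupport φ

/-- The classical time derivative `∂ₜ φ`. -/
def timeDeriv (φ : Torus3 × ℝ → ℝ) (p : Torus3 × ℝ) : ℝ :=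
  deriv (fun s : ℝ => φ (p.1, s)) p.2

/-- The classical spatial gradient `∇ φ`. -/
def spaceGrad (φ : Torus3 × ℝ → ℝ) (p : Torus3 × ℝ) : E3 :=
  WithLp.toLp 2 (fun k : Fin 3 =>
    deriv (fun h : ℝ => φ (p.1 + Pi.single k (h : UnitAddCircle), p.2)) 0)

/-- `G` is the weak (distributional) spatial gradient of `f` on `𝕋³ × (0,∞)`: both are locally
integrable and `∫∫ f ∂ₖψ = - ∫∫ Gₖ ψ` for all `ψ ∈ C_c^∞(𝕋³ × (0,∞))`. -/
structure IsWeakGrad (f : Torus3 × ℝ → ℝ) (G : Torus3 × ℝ → E3) : Prop where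
  locFun : MemLpLoc f 1
  locGrad : MemLpLoc G 1
  byParts : ∀ ψ : Torus3 × ℝ → ℝ, IsTest ψ → tsupport ψ ⊆ univ ×ˢ Ioi (0 : ℝ) →
    ∀ k : Fin 3, ∫ p, f p * spaceGrad ψ p k ∂stMeasure = - ∫ p, G p k * ψ p ∂stMeasure

/-- Derivative of a function on `[0,∞)` (one-sided at `0`). -/
def halfDeriv (β : ℝ → ℝ) : ℝ → ℝ := derivWithin β (Ici 0)

/-- Admissible initial data: `0 ≤ c⁰ᵢ ∈ L^∞(𝕋³)`, `∑ᵢ c⁰ᵢ = 1` and finite entropy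
`∫ ∑ᵢ c⁰ᵢ (ln c⁰ᵢ - 1) dx`. -/
structure IsInitialData {n : ℕ} (c₀ : Fin n → Torus3 → ℝ) : Prop where
  bounded : ∀ i, MemLp (c₀ i) ⊤ (volume : Measure Torus3)
  nonneg : ∀ i, ∀ᵐ x : Torus3, 0 ≤ c₀ i x
  sum_eq_one : ∀ᵐ x : Torus3, ∑ i, c₀ i x = 1
  finite_entropy :
    Integrable (fun x => ∑ i, c₀ i x * (Real.log (c₀ i x) - 1)) (volume : Measure Torus3)

/-- The molar flux `Jᵢ = cᵢ uᵢ`. -/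
def flux {n : ℕ} (c : Fin n → Torus3 × ℝ → ℝ) (u : Fin n → Torus3 × ℝ → E3) (i : Fin n)
    (p : Torus3 × ℝ) : E3 := c i p • u i p

/-- The left-hand side `- ∑_{j ≠ i} (cⱼ Jᵢ - cᵢ Jⱼ) / Dᵢⱼ` of the force-flux relations. -/
def force {n : ℕ} (D : Fin n → Fin n → ℝ) (c : Fin n → Torus3 × ℝ → ℝ)
    (u : Fin n → Torus3 × ℝ → E3) (i : Fin n) (p : Torus3 × ℝ) : E3 :=
  - ∑ j ∈ Finset.univ.erase i,
      (1 / D i j) • (c j p • flux c u i p - c i p • flux c u j p)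

/-- The renormalized weak formulation for one concentration `c` with velocity `u`, weak gradient
`g = ∇√c`, renormalization `β ∈ C²([0,∞))` and test function `φ`:
`∫ β(c⁰) φ(·,0) + ∫∫ β(c) ∂ₜφ + ∫∫ √c β'(c) √c u · ∇φ + 2 ∫∫ c β''(c) (∇√c · √c u) φ = 0`.
The two integrals that involve `u` are required to converge absolutely (the other two always do,
the data and the solution being bounded). -/
structure RenormalizedIdentity (c₀ : Torus3 → ℝ) (c : Torus3 × ℝ → ℝ) (u g : Torus3 × ℝ → E3)
    (β : ℝ → ℝ) (φ : Torus3 × ℝ → ℝ) : Prop where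
  integrable_flux : Integrable (fun p => √(c p) * halfDeriv β (c p) *
    inner ℝ (√(c p) • u p) (spaceGrad φ p)) stMeasure
  integrable_source : Integrable (fun p => c p * halfDeriv (halfDeriv β) (c p) *
    inner ℝ (g p) (√(c p) • u p) * φ p) stMeasure
  identity :
    (∫ x : Torus3, β (c₀ x) * φ (x, 0))
      + (∫ p, β (c p) * timeDeriv φ p ∂stMeasure)
      + (∫ p, √(c p) * halfDeriv β (c p) *
          inner ℝ (√(c p) • u p) (spaceGrad φ p) ∂stMeasure)
      + 2 * (∫ p, c p * halfDeriv (halfDeriv β) (c p) *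
          inner ℝ (g p) (√(c p) • u p) * φ p ∂stMeasure) = 0

/-- `c = (c₁,…,cₙ)`, with velocities `u = (u₁,…,uₙ)`, is a renormalized solution of the
Maxwell-Stefan system on `𝕋³ × (0,∞)` with diffusion coefficients `D` and initial data `c₀`.
Functions on `𝕋³ × (0,∞)` are understood up to null sets; accordingly the limit `t → 0` in
`initial_trace` is taken over `t > 0` up to null sets of times. -/
structure IsRenormalizedSolution {n : ℕ} (D : Fin n → Fin n → ℝ) (c₀ : Fin n → Torus3 → ℝ)
    (c : Fin n → Torus3 × ℝ → ℝ) (u : Fin n → Torus3 × ℝ → E3) : Prop where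
  measurable : ∀ i, AEStronglyMeasurable (c i) stMeasure
  bounds : ∀ i, ∀ᵐ p ∂stMeasure, 0 ≤ c i p ∧ c i p ≤ 1
  sum_eq_one : ∀ᵐ p ∂stMeasure, ∑ i, c i p = 1
  velocity_regularity : ∀ i, MemLpLoc (fun p => √(c i p) • u i p) 2
  renormalized : ∀ i, ∃ g : Torus3 × ℝ → E3,
    IsWeakGrad (fun p => √(c i p)) g ∧ MemLpLoc g 2 ∧
    ∀ φ : Torus3 × ℝ → ℝ, IsTest φ → ∀ β : ℝ → ℝ, ContDiffOn ℝ 2 β (Ici 0) →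
      RenormalizedIdentity (c₀ i) (c i) (u i) g β φ
  force_flux : ∀ i, IsWeakGrad (c i) (force D c u i)
  sum_flux : ∀ᵐ p ∂stMeasure, ∑ i, flux c u i p = 0
  initial_trace : ∀ i, ∀ β : ℝ → ℝ, ContinuousOn β (Ici 0) →
    Tendsto (fun t : ℝ => ∫ x : Torus3, |β (c i (x, t)) - β (c₀ i x)|)
      (𝓝[>] (0 : ℝ) ⊓ ae (volume : Measure ℝ)) (𝓝 0)

end MaxwellStefan

end

/-! The proof is an energy argument for the weighted square distance `F = ∑ (cᵢ - c̄ᵢ)² / (c̄ᵢ +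
δ)`, which is a quadratic substitute for the relative entropy. The shift `δ > 0` keeps the weight
bounded where `c̄ᵢ` vanishes, so no logarithm or lower bound on the concentrations enters.

Since `0 ≤ cᵢ ≤ 1`, bounded fluxes and the force-flux relations give bounded weak gradients. Taking
`β = id`, each `cᵢ` solves `∂ₜcᵢ + ∇·Jᵢ = 0` in the sense of distributions. Each species is thus an
`IsBoundedFlow`. For a pair of these, `integral_energy_eq_zero` gives the time derivative of the
integral of `(c - c̄)² / (c̄ + δ)` as the integral of an explicit rational expression, `energyRate`,
in the concentrations, fluxes and gradients. It is proved by convolving everything in space and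
time, computing classically, and passing to the limit by dominated convergence.

The pointwise estimate `exists_energyRate_bound` is the heart of the argument. With `K = J - J̄` and
`d = c - c̄`, the difference of the forces is minus the Maxwell-Stefan operator at `c̄` applied to
`K`, minus the operator at `d` applied to `J`. The first part is dissipative: by `msOp_coercive` it
produces at most `-κ₀ ∑ Kᵢ² / (c̄ᵢ + δ)`, provided `δ` is small. All other terms are of size `|K||d|
+ |d|²`, because `J`, `J̄` and the gradients are bounded. Young's inequality absorbs `|K||d|` into
the dissipation, so the production is at most `C F`.

Hence the spatial integral of `F` satisfies a weak Gronwall inequality. It tends to zero as `t → 0`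
by the initial traces (`energy_initial_small`), so `ae_eq_zero_of_gronwall` yields `F = 0`, that is
`c = c̄`. -/

noncomputable section

/-! ### Convolution with a kernel on an additive group -/

namespace MaxwellStefan

section Mollify

variable {G : Type*} [AddCommGroup G]

/-- `g'` is the derivative of `g` along the one-parameter subgroup `e`. -/
def HasDirDeriv (e : ℝ →+ G) (g g' : G → ℝ) : Prop :=
  ∀ p, HasDerivAt (fun h : ℝ => g (p + e h)) (g' p) 0

theorem HasDirDeriv.hasDerivAt {e : ℝ →+ G} {g g' : G → ℝ} (h : HasDirDeriv e g g') (p : G)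
    (s : ℝ) : HasDerivAt (fun h : ℝ => g (p + e h)) (g' (p + e s)) s := by
  have h1 : HasDerivAt (fun r : ℝ => g (p + e s + e r)) (g' (p + e s)) (s - s) := by
    simpa using h (p + e s)
  have h2 := HasDerivAt.comp_sub_const s s h1
  refine h2.congr_of_eventuallyEq (Eventually.of_forall fun r => ?_)
  simp [add_assoc]

theorem HasDirDeriv.mul {e : ℝ →+ G} {f f' g g' : G → ℝ} (hf : HasDirDeriv e f f')
    (hg : HasDirDeriv e g g') :
    HasDirDeriv e (fun p => f p * g p) (fun p => f' p * g p + f p * g' p) := fun p => by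
  have := HasDerivAt.fun_mul (hf p) (hg p)
  simpa using this

variable [TopologicalSpace G] [IsTopologicalAddGroup G] [MeasurableSpace G] [BorelSpace G]
  [SecondCountableTopology G] (μ : Measure G)

/-- The convolution `p ↦ ∫ f(q) ρ(p - q) dq`. -/
def mollify (f ρ : G → ℝ) (p : G) : ℝ := ∫ q, f q * ρ (p - q) ∂μ

variable {μ}

theorem integrable_mul_shift {f ρ : G → ℝ} (hf : Integrable f μ) (hρ : Continuous ρ) {M : ℝ}
    (hM : ∀ p, |ρ p| ≤ M) (p : G) : Integrable (fun q => f q * ρ (p - q)) μ :=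
  hf.mul_bdd (c := M) (by fun_prop) (Eventually.of_forall fun q => hM _)

theorem continuous_mollify {f ρ : G → ℝ} (hf : Integrable f μ) (hρ : Continuous ρ) {M : ℝ}
    (hM : ∀ p, |ρ p| ≤ M) : Continuous (mollify μ f ρ) := by
  refine continuous_of_dominated (bound := fun q => |f q| * M)
    (fun p => (integrable_mul_shift hf hρ hM p).aestronglyMeasurable) (fun p => ?_)
    (hf.abs.mul_const M) (Eventually.of_forall fun q => by fun_prop)
  refine Eventually.of_forall fun q => ?_
  rw [Real.norm_eq_abs, abs_mul]
  exact mul_le_mul_of_nonneg_left (hM _) (abs_nonneg _)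

/-- The derivative falls on the kernel, so `f` needs only to be integrable. -/
theorem hasDirDeriv_mollify {e : ℝ →+ G} {f ρ ρ' : G → ℝ} (hf : Integrable f μ)
    (hρ : Continuous ρ) (hρ' : Continuous ρ') {M M' : ℝ} (hM : ∀ p, |ρ p| ≤ M)
    (hM' : ∀ p, |ρ' p| ≤ M') (h : HasDirDeriv e ρ ρ') :
    HasDirDeriv e (mollify μ f ρ) (mollify μ f ρ') := by
  intro p
  have := hasDerivAt_integral_of_dominated_loc_of_deriv_le (μ := μ) (s := univ) (x₀ := (0 : ℝ))
    (F := fun h q => f q * ρ (p + e h - q)) (F' := fun h q => f q * ρ' (p + e h - q))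
    (bound := fun q => |f q| * M') univ_mem
    (Eventually.of_forall fun h => (integrable_mul_shift hf hρ hM _).aestronglyMeasurable)
    (integrable_mul_shift hf hρ hM _)
    (integrable_mul_shift hf hρ' hM' _).aestronglyMeasurable
    (Eventually.of_forall fun q h _ => ?_) (hf.abs.mul_const M')
    (Eventually.of_forall fun q s _ => ?_)
  · simpa [mollify] using this.2
  · rw [Real.norm_eq_abs, abs_mul]
    exact mul_le_mul_of_nonneg_left (hM' _) (abs_nonneg _)
  · have := (h.hasDerivAt (p - q) s).const_mul (f q)
    simpa [sub_add_eq_add_sub] using this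

/-- The integral of a compactly supported directional derivative vanishes. -/
theorem integral_dirDeriv_eq_zero [μ.IsAddRightInvariant] {e : ℝ →+ G} {g g' : G → ℝ}
    (h : HasDirDeriv e g g') (hg : Integrable g μ) (hg' : Continuous g') {bound : G → ℝ}
    (hb : Integrable bound μ) (hgb : ∀ p, ∀ s : ℝ, |s| < 1 → |g' (p + e s)| ≤ bound p) :
    ∫ p, g' p ∂μ = 0 := by
  have hsh : ∀ s : ℝ, Integrable (fun p => g (p + e s)) μ := fun s => hg.comp_add_right _
  have := hasDerivAt_integral_of_dominated_loc_of_deriv_le (μ := μ) (s := Metric.ball 0 1)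
    (x₀ := (0 : ℝ))
    (F := fun h p => g (p + e h)) (F' := fun h p => g' (p + e h))
    (bound := bound) (Metric.ball_mem_nhds _ one_pos)
    (Eventually.of_forall fun s => (hsh s).aestronglyMeasurable) (hsh 0)
    (by fun_prop)
    (Eventually.of_forall fun q s hs => hgb _ _ (by simpa using hs)) hb
    (Eventually.of_forall fun q s _ => h.hasDerivAt q s)
  -- By translation invariance the integral of `g (p + e s)` does not depend on `s`, so the
  -- derivative just computed is zero.
  have h2 := this.2
  simp only [integral_add_right_eq_self, map_zero, add_zero] at h2
  exact h2.unique (hasDerivAt_const _ _)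

omit [SecondCountableTopology G] in
theorem mollify_eq_integral_shift [μ.IsAddLeftInvariant] [μ.IsNegInvariant] (f ρ : G → ℝ)
    (p : G) : mollify μ f ρ p = ∫ r, ρ r * f (p - r) ∂μ := by
  rw [mollify, ← integral_sub_left_eq_self _ μ p]
  simp [mul_comm]

open scoped ENNReal in
/-- Convolution with kernels concentrating at the origin converges in `L¹`. -/
theorem tendsto_eLpNorm_mollify [R1Space G] [IsLocallyFiniteMeasure μ] [SFinite μ]
    [μ.IsAddHaarMeasure] [μ.InnerRegularCompactLTTop] [μ.IsNegInvariant] {f : G → ℝ} (hf : Integrable f μ)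
    {ρ : ℕ → G → ℝ} (hρc : ∀ n, Continuous (ρ n)) (hρ0 : ∀ n p, 0 ≤ ρ n p)
    (hρi : ∀ n, Integrable (ρ n) μ) (hρ1 : ∀ n, ∫ p, ρ n p ∂μ = 1)
    (hρs : ∀ U ∈ 𝓝 (0 : G), ∀ᶠ n in atTop, ∀ p, ρ n p ≠ 0 → p ∈ U) :
    Tendsto (fun n => eLpNorm (mollify μ f (ρ n) - f) 1 μ) atTop (𝓝 0) := by
  have hfm : MemLp f 1 μ := memLp_one_iff_integrable.2 hf
  -- Translations act continuously on `L¹`. Since the kernels have unit mass and shrink to the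
  -- origin, the error is an average of the `L¹` distances between `f` and its small translates.
  have hcont : Tendsto (fun r : G => eLpNorm (fun p => f (p - r) - f p) 1 μ) (𝓝 0) (𝓝 0) := by
    let C : G → C(G, G) := fun r => ⟨fun p => p - r, by fun_prop⟩
    have hC : Continuous C := ContinuousMap.continuous_of_continuous_uncurry _ (by
      simp only [Function.uncurry_def, C, ContinuousMap.coe_mk]; fun_prop)
    have hmp : ∀ r, MeasurePreserving (C r) μ μ := fun r => measurePreserving_sub_right μ r
    have h1 : Continuous fun r => Lp.compMeasurePreserving (E := ℝ) (p := 1) (C r) (hmp r)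
        (hfm.toLp f) := continuous_const.compMeasurePreservingLp hC hmp (by simp)
    have h2 := (h1.tendsto 0).edist (tendsto_const_nhds (x := hfm.toLp f))
    have h0 : Lp.compMeasurePreserving (E := ℝ) (p := 1) (C 0) (hmp 0) (hfm.toLp f) =
        hfm.toLp f := by
      rw [Lp.toLp_compMeasurePreserving hfm (hmp 0)]
      congr 1
      ext p; simp [C]
    rw [h0, edist_self] at h2
    refine h2.congr fun r => ?_
    rw [Lp.toLp_compMeasurePreserving hfm (hmp r), Lp.edist_toLp_toLp]
    rfl
  refine ENNReal.tendsto_nhds_zero.2 fun ε hε => ?_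
  have hU := ENNReal.tendsto_nhds_zero.1 hcont ε hε
  filter_upwards [hρs _ hU] with n hn
  have hfs : ∀ r, Integrable (fun p => f (p - r)) μ := fun r => hf.comp_sub_right r
  have hjm : AEStronglyMeasurable (fun z : G × G => f (z.1 - z.2) - f z.1) (μ.prod μ) := by
    refine AEStronglyMeasurable.sub ?_ ?_
    · exact hf.aestronglyMeasurable.comp_quasiMeasurePreserving
        (quasiMeasurePreserving_sub_of_right_invariant μ μ)
    · exact hf.aestronglyMeasurable.comp_quasiMeasurePreserving
        Measure.quasiMeasurePreserving_fst
  have hb : ∀ p, Integrable (fun r => ρ n r * f (p - r)) μ → ‖(mollify μ f (ρ n) - f) p‖ₑ ≤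
      ∫⁻ r, ENNReal.ofReal (ρ n r) * ‖f (p - r) - f p‖ₑ ∂μ := by
    intro p hp
    have : (mollify μ f (ρ n) - f) p = ∫ r, ρ n r * (f (p - r) - f p) ∂μ := by
      simp only [mul_sub]
      rw [integral_sub hp ((hρi n).mul_const _), integral_mul_const, hρ1, one_mul, Pi.sub_apply,
        mollify_eq_integral_shift]
    rw [this]
    refine (enorm_integral_le_lintegral_enorm _).trans (lintegral_mono fun r => ?_)
    rw [enorm_mul, Real.enorm_of_nonneg (hρ0 n r)]
  have hprod : ∀ᵐ p ∂μ, Integrable (fun r => ρ n r * f (p - r)) μ := by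
    have h3 : Integrable (fun z : G × G => ρ n z.2 * f (z.1 - z.2)) (μ.prod μ) := by
      rw [integrable_prod_iff' ?_]
      · refine ⟨Eventually.of_forall fun r => (hfs r).const_mul (ρ n r), ?_⟩
        simp only [norm_mul, integral_const_mul]
        simp only [integral_sub_right_eq_self (fun x => ‖f x‖)]
        exact (hρi n).norm.mul_const _
      · exact ((hρc n).comp continuous_snd).aestronglyMeasurable.mul
          (hf.aestronglyMeasurable.comp_quasiMeasurePreserving
          (quasiMeasurePreserving_sub_of_right_invariant μ μ))
    exact h3.prod_right_ae
  rw [eLpNorm_one_eq_lintegral_enorm]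
  calc ∫⁻ p, ‖(mollify μ f (ρ n) - f) p‖ₑ ∂μ
      ≤ ∫⁻ p, ∫⁻ r, ENNReal.ofReal (ρ n r) * ‖f (p - r) - f p‖ₑ ∂μ ∂μ :=
        lintegral_mono_ae (hprod.mono fun p hp => hb p hp)
    _ = ∫⁻ r, ∫⁻ p, ENNReal.ofReal (ρ n r) * ‖f (p - r) - f p‖ₑ ∂μ ∂μ := by
        refine lintegral_lintegral_swap ?_
        exact ((hρc n).comp continuous_snd).measurable.ennreal_ofReal.aemeasurable.mul hjm.enorm
    _ = ∫⁻ r, ENNReal.ofReal (ρ n r) * eLpNorm (fun p => f (p - r) - f p) 1 μ ∂μ := by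
        refine lintegral_congr fun r => ?_
        rw [lintegral_const_mul'', eLpNorm_one_eq_lintegral_enorm]
        exact ((hfs r).sub hf).aestronglyMeasurable.enorm
    _ ≤ ∫⁻ r, ENNReal.ofReal (ρ n r) * ε ∂μ := by
        refine lintegral_mono fun r => ?_
        by_cases hr : ρ n r = 0
        · simp [hr]
        · gcongr
          exact hn r hr
    _ = ε := by
        rw [lintegral_mul_const _ (hρc n).measurable.ennreal_ofReal,
          ← ofReal_integral_eq_lintegral_ofReal (hρi n) (Eventually.of_forall (hρ0 n)), hρ1]
        simp

end Mollify

/-! ### Coercivity of the Maxwell-Stefan matrix and the pointwise entropy inequality -/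

/-- The Maxwell-Stefan matrix at the composition `c` applied to the fluxes `K`. -/
def msOp {n : ℕ} (κ : Fin n → Fin n → ℝ) (c K : Fin n → ℝ) (i : Fin n) : ℝ :=
  ∑ j, κ i j * (c j * K i - c i * K j)

/-- With the weight `1 / cᵢ` in place of `1 / (cᵢ + s²)`, the quadratic form would symmetrize to a
sum of squares. With the shifted weight, each summand splits as `Y - Z`. The part `Y` is the exact
form at `c + s²`, where `Y i j + Y j i` is a square, so `κ` may be replaced by its lower bound `κ₀`;
then `∑ K = 0` kills the mixed terms. The part `Z` is an error of order `s`, and `hsΛ` makes it at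
most half of what `Y` gives. -/
theorem msOp_coercive {n : ℕ} {κ : Fin n → Fin n → ℝ} {κ₀ Λ s : ℝ} (hκ₀ : 0 < κ₀)
    (hκ : ∀ i j, κ₀ ≤ κ i j) (hκΛ : ∀ i j, κ i j ≤ Λ) (hsymm : ∀ i j, κ i j = κ j i)
    (hs : 0 < s) (hs1 : s ≤ 1) (hsΛ : 5 * Λ * n * s ≤ κ₀) {c K : Fin n → ℝ}
    (hc0 : ∀ i, 0 ≤ c i) (hc1 : ∀ i, c i ≤ 1) (hcs : ∑ i, c i = 1) (hK : ∑ i, K i = 0) :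
    κ₀ / 2 * ∑ i, K i ^ 2 / (c i + s ^ 2) ≤ ∑ i, K i * msOp κ c K i / (c i + s ^ 2) := by
  have hγ : ∀ i, 0 < c i + s ^ 2 := fun i => by have := hc0 i; positivity
  set X : Fin n → ℝ := fun i => K i ^ 2 / (c i + s ^ 2) with hX
  have hX0 : ∀ i, 0 ≤ X i := fun i => div_nonneg (sq_nonneg _) (hγ i).le
  set Y : Fin n → Fin n → ℝ := fun i j => (c j + s ^ 2) * X i - K i * K j with hY
  set Z : Fin n → Fin n → ℝ := fun i j => s ^ 2 * ((K i - K j) * K i / (c i + s ^ 2)) with hZ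
  have hterm : ∀ i, K i * msOp κ c K i / (c i + s ^ 2) =
      ∑ j, κ i j * Y i j - ∑ j, κ i j * Z i j := by
    intro i
    rw [msOp, Finset.mul_sum, Finset.sum_div, ← Finset.sum_sub_distrib]
    refine Finset.sum_congr rfl fun j _ => ?_
    have := (hγ i).ne'
    simp only [hY, hZ, hX]
    field_simp
    ring
  have hYsum : ∑ i, ∑ j, Y i j = (1 + n * s ^ 2) * ∑ i, X i := by
    simp only [hY, Finset.sum_sub_distrib, ← Finset.sum_mul, ← Finset.mul_sum, hK,
      Finset.sum_add_distrib, hcs]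
    simp [Finset.mul_sum]
  have hsq : ∀ i j, 0 ≤ Y i j + Y j i := by
    intro i j
    have h1 : Y i j + Y j i = (c i + s ^ 2) * (c j + s ^ 2) *
        (K i / (c i + s ^ 2) - K j / (c j + s ^ 2)) ^ 2 := by
      have := (hγ i).ne'
      have := (hγ j).ne'
      simp only [hY, hX]
      field_simp
      ring
    rw [h1]
    exact mul_nonneg (mul_pos (hγ i) (hγ j)).le (sq_nonneg _)
  have hYlow : κ₀ * ∑ i, ∑ j, Y i j ≤ ∑ i, ∑ j, κ i j * Y i j := by
    have h2 : ∑ i, ∑ j, (κ i j - κ₀) * Y i j = ∑ i, ∑ j, (κ i j - κ₀) * Y j i := by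
      rw [Finset.sum_comm]
      exact Finset.sum_congr rfl fun i _ => Finset.sum_congr rfl fun j _ => by rw [hsymm]
    have h3 : 0 ≤ ∑ i, ∑ j, (κ i j - κ₀) * Y i j + ∑ i, ∑ j, (κ i j - κ₀) * Y j i := by
      simp only [← Finset.sum_add_distrib, ← mul_add]
      exact Finset.sum_nonneg fun i _ => Finset.sum_nonneg fun j _ =>
        mul_nonneg (sub_nonneg.2 (hκ i j)) (hsq i j)
    have h4 : ∑ i, ∑ j, (κ i j - κ₀) * Y i j =
        ∑ i, ∑ j, κ i j * Y i j - κ₀ * ∑ i, ∑ j, Y i j := by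
      simp only [sub_mul, Finset.sum_sub_distrib, Finset.mul_sum]
    linarith
  have hZup : ∀ i j, κ i j * Z i j ≤ Λ * (3 / 2 * s * X i + s * X j) := by
    intro i j
    have hκp : 0 < κ i j := hκ₀.trans_le (hκ i j)
    have hb : Z i j ≤ 3 / 2 * s * X i + s * X j := by
      -- Young's inequality with weight `s`; the gap is the complete square in `h6`. The leftover
      -- `s² Kⱼ² / (cᵢ + s²)` is at most `Kⱼ²`, whatever the size of `cᵢ`, and this allows
      -- concentrations to vanish.
      have h5 : Z i j ≤ s ^ 2 * X i + (s / 2 * X i + s * (s ^ 2 * K j ^ 2 / (c i + s ^ 2)) / 2) := by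
        have h6 : s ^ 2 * X i + (s / 2 * X i + s * (s ^ 2 * K j ^ 2 / (c i + s ^ 2)) / 2) - Z i j
            = s * (K i + s * K j) ^ 2 / (2 * (c i + s ^ 2)) := by
          have := (hγ i).ne'
          simp only [hZ, hX]
          field_simp
          ring
        have h7 : 0 ≤ s * (K i + s * K j) ^ 2 / (2 * (c i + s ^ 2)) := by
          have := hγ i
          positivity
        linarith
      have h8 : s ^ 2 * K j ^ 2 / (c i + s ^ 2) ≤ K j ^ 2 := by
        rw [div_le_iff₀ (hγ i)]
        nlinarith [mul_nonneg (hc0 i) (sq_nonneg (K j))]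
      have h9 : K j ^ 2 ≤ 2 * X j := by
        simp only [hX]
        rw [← mul_div_assoc, le_div_iff₀ (hγ j)]
        have : c j + s ^ 2 ≤ 2 := by nlinarith [hc1 j]
        nlinarith [sq_nonneg (K j)]
      have h10 : s ^ 2 * X i ≤ s * X i := by
        have : s ^ 2 ≤ s := by nlinarith
        exact mul_le_mul_of_nonneg_right this (hX0 i)
      nlinarith
    have hnn : 0 ≤ 3 / 2 * s * X i + s * X j := by
      have := hX0 i
      have := hX0 j
      positivity
    exact (mul_le_mul_of_nonneg_left hb hκp.le).trans (mul_le_mul_of_nonneg_right (hκΛ i j) hnn)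
  have hZsum : ∑ i, ∑ j, κ i j * Z i j ≤ κ₀ / 2 * ∑ i, X i := by
    calc ∑ i, ∑ j, κ i j * Z i j ≤ ∑ i, ∑ j, Λ * (3 / 2 * s * X i + s * X j) :=
          Finset.sum_le_sum fun i _ => Finset.sum_le_sum fun j _ => hZup i j
      -- The two double sums contribute `3/2 + 1 = 5/2`, which is the source of the factor 5 in
      -- `hsΛ`.
      _ = 5 * Λ * n * s / 2 * ∑ i, X i := by
          simp only [← Finset.mul_sum, Finset.sum_add_distrib, Finset.sum_const,
            Finset.card_univ, Fintype.card_fin, nsmul_eq_mul]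
          ring
      _ ≤ κ₀ / 2 * ∑ i, X i :=
          mul_le_mul_of_nonneg_right (by linarith) (Finset.sum_nonneg fun i _ => hX0 i)
  have hXs : 0 ≤ ∑ i, X i := Finset.sum_nonneg fun i _ => hX0 i
  have hns : 0 ≤ (n : ℝ) * s ^ 2 := by positivity
  simp only [hterm, Finset.sum_sub_distrib]
  rw [hYsum] at hYlow
  nlinarith [mul_nonneg hκ₀.le (mul_nonneg hns hXs)]

/-- Contribution of one species and one spatial direction to the production of
`∑ (cᵢ - c̄ᵢ)² / (c̄ᵢ + δ)`. -/
def energyRate (δ a b J J' G G' : ℝ) : ℝ :=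
  2 * (J - J') * (G - G') / (b + δ) - 2 * (a - b) / (b + δ) ^ 2 * ((J - J') * G' + J' * (G - G'))
    + 2 * (a - b) ^ 2 / (b + δ) ^ 3 * (J' * G')

/-- The Maxwell-Stefan operator is bilinear in composition and flux. This one bound serves for the
gradients and for both parts of the difference of the forces. -/
theorem abs_sum_kernel_le {n : ℕ} {κ : Fin n → Fin n → ℝ} {Λ : ℝ} (hκ0 : ∀ i j, 0 ≤ κ i j)
    (hκΛ : ∀ i j, κ i j ≤ Λ) {x y : Fin n → ℝ} {A B : ℝ} (hx : ∀ i, |x i| ≤ A)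
    (hy : ∀ i, |y i| ≤ B) (i : Fin n) :
    |∑ j, κ i j * (x j * y i - x i * y j)| ≤ 2 * n * Λ * (A * B) := by
  have hA : 0 ≤ A := (abs_nonneg _).trans (hx i)
  calc |∑ j, κ i j * (x j * y i - x i * y j)|
      ≤ ∑ j, |κ i j * (x j * y i - x i * y j)| := Finset.abs_sum_le_sum_abs _ _
    _ ≤ ∑ _j : Fin n, Λ * (2 * (A * B)) := by
        refine Finset.sum_le_sum fun j _ => ?_
        rw [abs_mul, abs_of_nonneg (hκ0 i j)]
        refine mul_le_mul (hκΛ i j) ?_ (abs_nonneg _) ((hκ0 i j).trans (hκΛ i j))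
        refine (abs_sub _ _).trans ?_
        rw [abs_mul, abs_mul]
        have h1 := mul_le_mul (hx j) (hy i) (abs_nonneg _) hA
        have h2 := mul_le_mul (hx i) (hy j) (abs_nonneg _) hA
        linarith
    _ = 2 * n * Λ * (A * B) := by simp; ring

/-- Here `A` is the dissipative part of the force difference and `Q` the part caused by the
difference of compositions. Once `-2 (J - J') A / (b + δ)` is set aside, every remaining term has a
factor `|a - b|` or `Q`, multiplied by a quantity linear in `k` and `e`; hence the form `k e + e²`.
-/
theorem energyRate_le {δ a b J J' G G' A Q M P k e : ℝ} (hδ : 0 < δ) (hb : 0 ≤ b)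
    (hG : G - G' = -A - Q) (hJ' : |J'| ≤ M) (hG' : |G'| ≤ P) (hA : |A| ≤ P * k)
    (hQ : |Q| ≤ P * e) (hK : |J - J'| ≤ k) (hd : |a - b| ≤ e) :
    energyRate δ a b J J' G G' ≤ -2 * ((J - J') * A / (b + δ)) +
      (2 * P / δ + 2 * P * (1 + M) / δ ^ 2 + 2 * M * P / δ ^ 3) * (k * e + e ^ 2) := by
  have hγ : 0 < b + δ := by positivity
  have hM : 0 ≤ M := (abs_nonneg _).trans hJ'
  have hP : 0 ≤ P := (abs_nonneg _).trans hG'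
  have hk : 0 ≤ k := (abs_nonneg _).trans hK
  have he : 0 ≤ e := (abs_nonneg _).trans hd
  have hR : energyRate δ a b J J' G G' = -2 * ((J - J') * A / (b + δ)) +
      (-(2 * ((J - J') * Q) / (b + δ)) - 2 * ((a - b) * ((J - J') * G' + J' * (-A - Q))) / (b + δ) ^ 2
       + 2 * ((a - b) ^ 2 * (J' * G')) / (b + δ) ^ 3) := by
    rw [energyRate, hG]
    field_simp
    ring
  have hdiv : ∀ (m : ℕ) (x y : ℝ), |x| ≤ y → |x / (b + δ) ^ m| ≤ y / δ ^ m := by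
    intro m x y hxy
    rw [abs_div, abs_of_pos (pow_pos hγ m)]
    exact div_le_div₀ ((abs_nonneg _).trans hxy) hxy (by positivity)
      (pow_le_pow_left₀ hδ.le (by linarith) m)
  have h1 : |2 * ((J - J') * Q)| ≤ 2 * (k * (P * e)) := by
    rw [abs_mul, abs_mul, abs_two]
    gcongr
  have h2 : |2 * ((a - b) * ((J - J') * G' + J' * (-A - Q)))| ≤
      2 * (e * (k * P + M * (P * k + P * e))) := by
    rw [abs_mul, abs_mul, abs_two]
    gcongr
    refine (abs_add_le _ _).trans ?_
    rw [abs_mul, abs_mul]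
    gcongr
    refine (abs_sub _ _).trans ?_
    rw [abs_neg]
    gcongr
  have h3 : |2 * ((a - b) ^ 2 * (J' * G'))| ≤ 2 * (e ^ 2 * (M * P)) := by
    rw [abs_mul, abs_mul, abs_mul, abs_two, abs_pow]
    gcongr
  have g1 := hdiv 1 _ _ h1
  have g2 := hdiv 2 _ _ h2
  have g3 := hdiv 3 _ _ h3
  rw [pow_one, pow_one] at g1
  have f1 : 2 * (k * (P * e)) / δ ≤ 2 * P / δ * (k * e + e ^ 2) := by
    have : 2 * P / δ * (k * e + e ^ 2) - 2 * (k * (P * e)) / δ = 2 * P / δ * e ^ 2 := by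
      field_simp; ring
    have : 0 ≤ 2 * P / δ * e ^ 2 := by positivity
    linarith
  have f2 : 2 * (e * (k * P + M * (P * k + P * e))) / δ ^ 2 ≤
      2 * P * (1 + M) / δ ^ 2 * (k * e + e ^ 2) := by
    have : 2 * P * (1 + M) / δ ^ 2 * (k * e + e ^ 2) -
        2 * (e * (k * P + M * (P * k + P * e))) / δ ^ 2 = 2 * P / δ ^ 2 * e ^ 2 := by
      field_simp; ring
    have : 0 ≤ 2 * P / δ ^ 2 * e ^ 2 := by positivity
    linarith
  have f3 : 2 * (e ^ 2 * (M * P)) / δ ^ 3 ≤ 2 * M * P / δ ^ 3 * (k * e + e ^ 2) := by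
    have : 2 * M * P / δ ^ 3 * (k * e + e ^ 2) - 2 * (e ^ 2 * (M * P)) / δ ^ 3 =
        2 * M * P / δ ^ 3 * (k * e) := by
      field_simp; ring
    have : 0 ≤ 2 * M * P / δ ^ 3 * (k * e) := by positivity
    linarith
  rw [hR]
  have := (abs_le.1 g1).1
  have := (abs_le.1 g2).1
  have := (abs_le.1 g3).2
  linarith

/-- Pointwise bound of the energy production by the energy, for fluxes bounded by `M`. -/
theorem exists_energyRate_bound {n : ℕ} {κ : Fin n → Fin n → ℝ} {κ₀ Λ M : ℝ} (hκ₀ : 0 < κ₀)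
    (hκ : ∀ i j, κ₀ ≤ κ i j) (hκΛ : ∀ i j, κ i j ≤ Λ) (hsymm : ∀ i j, κ i j = κ j i)
    (hM : 0 ≤ M) :
    ∃ δ > 0, ∃ C ≥ 0, ∀ c c' J J' : Fin n → ℝ, (∀ i, 0 ≤ c i) → (∀ i, c i ≤ 1) →
      (∀ i, 0 ≤ c' i) → (∀ i, c' i ≤ 1) → ∑ i, c' i = 1 → (∀ i, |J i| ≤ M) → (∀ i, |J' i| ≤ M) →
      ∑ i, J i = 0 → ∑ i, J' i = 0 →
      ∑ i, energyRate δ (c i) (c' i) (J i) (J' i) (-msOp κ c J i) (-msOp κ c' J' i) ≤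
        C * ∑ i, (c i - c' i) ^ 2 / (c' i + δ) := by
  rcases Nat.eq_zero_or_pos n with rfl | hn
  · exact ⟨1, one_pos, 0, le_rfl, fun _ _ _ _ _ _ _ _ _ _ _ _ _ => by simp⟩
  have hn1 : (1 : ℝ) ≤ n := by exact_mod_cast hn
  have hΛ : 0 < Λ := hκ₀.trans_le ((hκ ⟨0, hn⟩ ⟨0, hn⟩).trans (hκΛ _ _))
  have hκ0 : ∀ i j, 0 ≤ κ i j := fun i j => hκ₀.le.trans (hκ i j)
  -- The largest `s` permitted by `msOp_coercive`; the shift in the energy is then `δ = s²`.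
  set s : ℝ := min 1 (κ₀ / (5 * Λ * n)) with hsdef
  have hs : 0 < s := lt_min one_pos (by positivity)
  have hs1 : s ≤ 1 := min_le_left _ _
  have hsΛ : 5 * Λ * n * s ≤ κ₀ := by
    have h := min_le_right 1 (κ₀ / (5 * Λ * n))
    rw [← hsdef, le_div_iff₀ (by positivity)] at h
    linarith
  have hδ : 0 < s ^ 2 := by positivity
  -- One constant that dominates `2nΛM` (for `G'` and `Q`) and `2nΛ` (for `A`).
  set P : ℝ := 2 * n * Λ * (M + 1) with hP
  have hP0 : 0 ≤ P := by positivity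
  set B : ℝ := 2 * P / s ^ 2 + 2 * P * (1 + M) / (s ^ 2) ^ 2 + 2 * M * P / (s ^ 2) ^ 3 with hB
  have hB0 : 0 ≤ B := by positivity
  set C₁ : ℝ := n * B + n ^ 3 * B ^ 2 / (2 * κ₀) with hC₁
  have hC₁0 : 0 ≤ C₁ := by positivity
  refine ⟨s ^ 2, hδ, C₁ * (2 * n), by positivity, ?_⟩
  intro c c' J J' hc0 hc1 hc0' hc1' hcs' hJ hJ' hJs hJs'
  have hγ : ∀ i, 0 < c' i + s ^ 2 := fun i => by have := hc0' i; positivity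
  have hγ2 : ∀ i, c' i + s ^ 2 ≤ 2 := fun i => by nlinarith [hc1' i]
  set K : Fin n → ℝ := fun i => J i - J' i with hK
  set d : Fin n → ℝ := fun i => c i - c' i with hd
  set k : ℝ := ∑ i, |K i| with hk
  set e : ℝ := ∑ i, |d i| with he
  have hKk : ∀ i, |K i| ≤ k := fun i =>
    Finset.single_le_sum (f := fun i => |K i|) (fun i _ => abs_nonneg _) (Finset.mem_univ i)
  have hde : ∀ i, |d i| ≤ e := fun i =>
    Finset.single_le_sum (f := fun i => |d i|) (fun i _ => abs_nonneg _) (Finset.mem_univ i)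
  have hk0 : 0 ≤ k := Finset.sum_nonneg fun i _ => abs_nonneg _
  have he0 : 0 ≤ e := Finset.sum_nonneg fun i _ => abs_nonneg _
  have hc'abs : ∀ i, |c' i| ≤ 1 := fun i => by rw [abs_of_nonneg (hc0' i)]; exact hc1' i
  have hnΛ : 0 ≤ 2 * n * Λ := by positivity
  have hrate : ∀ i, energyRate (s ^ 2) (c i) (c' i) (J i) (J' i) (-msOp κ c J i)
      (-msOp κ c' J' i) ≤ -2 * (K i * msOp κ c' K i / (c' i + s ^ 2)) + B * (k * e + e ^ 2) := by
    intro i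
    -- Bilinear splitting: the operator at `c'` acts on `K`, and the operator at `d` acts on `J`.
    refine energyRate_le (Q := msOp κ d J i) hδ (hc0' i) ?_ (hJ' i) ?_ ?_ ?_ (hKk i) (hde i)
    · simp only [msOp, ← Finset.sum_neg_distrib, ← Finset.sum_sub_distrib, hK, hd]
      exact Finset.sum_congr rfl fun j _ => by ring
    · rw [abs_neg]
      refine (abs_sum_kernel_le hκ0 hκΛ hc'abs hJ' i).trans ?_
      rw [hP]
      gcongr
      linarith
    · refine (abs_sum_kernel_le hκ0 hκΛ hc'abs hKk i).trans ?_
      rw [hP, mul_assoc (2 * n * Λ)]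
      gcongr
      linarith
    · refine (abs_sum_kernel_le hκ0 hκΛ hde hJ i).trans ?_
      rw [hP, mul_assoc (2 * n * Λ), mul_comm e]
      gcongr
      linarith
  have hKs : ∑ i, K i = 0 := by simp [hK, Finset.sum_sub_distrib, hJs, hJs']
  have hco := msOp_coercive hκ₀ hκ hκΛ hsymm hs hs1 hsΛ hc0' hc1' hcs' hKs
  have hk2 : k ^ 2 ≤ 2 * n * ∑ i, K i ^ 2 / (c' i + s ^ 2) := by
    have h1 : k ^ 2 ≤ n * ∑ i, |K i| ^ 2 := by
      simpa using sq_sum_le_card_mul_sum_sq (s := Finset.univ) (f := fun i => |K i|)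
    have h2 : ∑ i, |K i| ^ 2 ≤ 2 * ∑ i, K i ^ 2 / (c' i + s ^ 2) := by
      rw [Finset.mul_sum]
      refine Finset.sum_le_sum fun i _ => ?_
      rw [sq_abs, ← mul_div_assoc, le_div_iff₀ (hγ i)]
      nlinarith [sq_nonneg (K i), hγ2 i]
    calc _ ≤ _ := h1
      _ ≤ n * (2 * ∑ i, K i ^ 2 / (c' i + s ^ 2)) := mul_le_mul_of_nonneg_left h2 (by positivity)
      _ = _ := by ring
  have he2 : e ^ 2 ≤ 2 * n * ∑ i, d i ^ 2 / (c' i + s ^ 2) := by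
    have h1 : e ^ 2 ≤ n * ∑ i, |d i| ^ 2 := by
      simpa using sq_sum_le_card_mul_sum_sq (s := Finset.univ) (f := fun i => |d i|)
    have h2 : ∑ i, |d i| ^ 2 ≤ 2 * ∑ i, d i ^ 2 / (c' i + s ^ 2) := by
      rw [Finset.mul_sum]
      refine Finset.sum_le_sum fun i _ => ?_
      rw [sq_abs, ← mul_div_assoc, le_div_iff₀ (hγ i)]
      nlinarith [sq_nonneg (d i), hγ2 i]
    calc _ ≤ _ := h1
      _ ≤ n * (2 * ∑ i, d i ^ 2 / (c' i + s ^ 2)) := mul_le_mul_of_nonneg_left h2 (by positivity)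
      _ = _ := by ring
  have hsum : ∑ i, energyRate (s ^ 2) (c i) (c' i) (J i) (J' i) (-msOp κ c J i)
      (-msOp κ c' J' i) ≤ -2 * ∑ i, K i * msOp κ c' K i / (c' i + s ^ 2) +
        n * (B * (k * e + e ^ 2)) := by
    refine (Finset.sum_le_sum fun i _ => hrate i).trans_eq ?_
    rw [Finset.sum_add_distrib, ← Finset.mul_sum]
    simp
  -- The coefficient `κ₀ / (2n)` of `k²` is chosen so that, by `hk2`, this term is at most the
  -- dissipation `κ₀ ∑ K² / (c' + s²)`.
  have hyoung : n * B * (k * e) ≤ κ₀ / (2 * n) * k ^ 2 + n ^ 3 * B ^ 2 / (2 * κ₀) * e ^ 2 := by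
    have : κ₀ / (2 * n) * k ^ 2 + n ^ 3 * B ^ 2 / (2 * κ₀) * e ^ 2 - n * B * (k * e) =
        (κ₀ * k - n ^ 2 * B * e) ^ 2 / (2 * n * κ₀) := by
      field_simp; ring
    have : 0 ≤ (κ₀ * k - n ^ 2 * B * e) ^ 2 / (2 * n * κ₀) := by positivity
    linarith
  have hkk : κ₀ / (2 * n) * k ^ 2 ≤ κ₀ * ∑ i, K i ^ 2 / (c' i + s ^ 2) := by
    calc κ₀ / (2 * n) * k ^ 2 ≤ κ₀ / (2 * n) * (2 * n * ∑ i, K i ^ 2 / (c' i + s ^ 2)) := by gcongr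
      _ = _ := by field_simp
  calc _ ≤ -2 * ∑ i, K i * msOp κ c' K i / (c' i + s ^ 2) + n * (B * (k * e + e ^ 2)) := hsum
    _ ≤ C₁ * e ^ 2 := by rw [hC₁]; linarith
    _ ≤ C₁ * (2 * n * ∑ i, d i ^ 2 / (c' i + s ^ 2)) := by gcongr
    _ = _ := by ring

/-! ### Smoothing kernels on the torus -/

instance : (volume : Measure Torus3).IsAddHaarMeasure :=
  inferInstanceAs (volume : Measure (Fin 3 → UnitAddCircle)).IsAddHaarMeasure

instance : IsProbabilityMeasure (volume : Measure UnitAddCircle) :=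
  ⟨by simp⟩

instance : IsProbabilityMeasure (volume : Measure Torus3) :=
  inferInstanceAs (IsProbabilityMeasure (Measure.pi fun _ : Fin 3 => (volume : Measure UnitAddCircle)))

instance : (volume : Measure (Torus3 × ℝ)).IsAddHaarMeasure :=
  Measure.prod.instIsAddHaarMeasure _ _

instance : (volume : Measure (Torus3 × ℝ)).Regular :=
  Measure.Regular.of_sigmaCompactSpace_of_isLocallyFiniteMeasure _

instance : (volume : Measure (Torus3 × ℝ)).IsNegInvariant :=
  Measure.IsAddHaarMeasure.isNegInvariant_of_regular _

theorem stMeasure_eq : stMeasure = (volume : Measure (Torus3 × ℝ)).restrict (univ ×ˢ Ioi 0) := by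
  rw [stMeasure, ← Measure.restrict_univ (μ := (volume : Measure Torus3)), Measure.prod_restrict]
  rfl

/-- Translations in the `k`-th space direction. -/
def spaceDir (k : Fin 3) : ℝ →+ Torus3 × ℝ :=
  (AddMonoidHom.inl Torus3 ℝ).comp
    ((AddMonoidHom.single (fun _ : Fin 3 => UnitAddCircle) k).comp (QuotientAddGroup.mk' _))

/-- Translations in time. -/
def timeDir : ℝ →+ Torus3 × ℝ := AddMonoidHom.inr Torus3 ℝ

theorem spaceDir_apply (k : Fin 3) (h : ℝ) :
    spaceDir k h = (Pi.single k (h : UnitAddCircle), 0) := rfl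

theorem timeDir_apply (h : ℝ) : timeDir h = ((0 : Torus3), h) := rfl

/-- `cos (2πx)` as a function on the circle. -/
def circleCos (x : UnitAddCircle) : ℝ := (fourier 1 x).re

/-- `sin (2πx)` as a function on the circle. -/
def circleSin (x : UnitAddCircle) : ℝ := (fourier 1 x).im

theorem circleCos_coe (x : ℝ) : circleCos (x : UnitAddCircle) = Real.cos (2 * Real.pi * x) := by
  rw [circleCos, fourier_coe_apply, ← Complex.exp_ofReal_mul_I_re]
  congr 2
  push_cast
  ring

theorem circleSin_coe (x : ℝ) : circleSin (x : UnitAddCircle) = Real.sin (2 * Real.pi * x) := by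
  rw [circleSin, fourier_coe_apply, ← Complex.exp_ofReal_mul_I_im]
  congr 2
  push_cast
  ring

theorem continuous_circleCos : Continuous circleCos :=
  Complex.continuous_re.comp (fourier 1).continuous

theorem continuous_circleSin : Continuous circleSin :=
  Complex.continuous_im.comp (fourier 1).continuous

theorem circleCos_le_one (x : UnitAddCircle) : circleCos x ≤ 1 := by
  induction x using QuotientAddGroup.induction_on with
  | H x => exact (circleCos_coe x).trans_le (Real.cos_le_one _)

/-- A unit complex number with real part 1 equals 1, and the circle embeds injectively in the
complex numbers. -/
theorem eq_zero_of_circleCos_eq_one {x : UnitAddCircle} (h : circleCos x = 1) : x = 0 := by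
  have h1 : fourier 1 x = 1 := by
    have h2 : ‖(fourier 1 x : ℂ)‖ = 1 := by
      rw [fourier_apply]
      exact Circle.norm_coe _
    have h3 := Complex.sq_norm (fourier 1 x)
    rw [h2, Complex.normSq_apply] at h3
    rw [circleCos] at h
    refine Complex.ext (by simpa using h) ?_
    rw [h] at h3
    have h4 : (fourier 1 x).im * (fourier 1 x).im = 0 := by linarith
    simpa using h4
  have h5 : AddCircle.toCircle x = 1 := by
    ext
    simpa [fourier_apply] using h1
  exact AddCircle.injective_toCircle one_ne_zero (by rw [h5, AddCircle.toCircle_zero])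

/-- A smooth function on `𝕋³ × ℝ` vanishing exactly at the origin. -/
def bumpWeight (p : Torus3 × ℝ) : ℝ := ∑ k, (1 - circleCos (p.1 k)) + p.2 ^ 2

theorem continuous_bumpWeight : Continuous bumpWeight := by
  have := continuous_circleCos
  unfold bumpWeight
  fun_prop

theorem sq_time_le_bumpWeight (p : Torus3 × ℝ) : p.2 ^ 2 ≤ bumpWeight p := by
  have : 0 ≤ ∑ k, (1 - circleCos (p.1 k)) :=
    Finset.sum_nonneg fun k _ => sub_nonneg.2 (circleCos_le_one _)
  rw [bumpWeight]
  linarith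

theorem bumpWeight_nonneg (p : Torus3 × ℝ) : 0 ≤ bumpWeight p :=
  (sq_nonneg _).trans (sq_time_le_bumpWeight p)

theorem eq_zero_of_bumpWeight_eq_zero {p : Torus3 × ℝ} (h : bumpWeight p = 0) : p = 0 := by
  have h0 : ∀ k ∈ Finset.univ, 0 ≤ 1 - circleCos (p.1 k) :=
    fun k _ => sub_nonneg.2 (circleCos_le_one _)
  have h1 := Finset.sum_nonneg h0
  have h2 := sq_nonneg p.2
  rw [bumpWeight] at h
  have h3 : ∑ k, (1 - circleCos (p.1 k)) = 0 := by linarith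
  have h4 : p.2 ^ 2 = 0 := by linarith
  rw [Finset.sum_eq_zero_iff_of_nonneg h0] at h3
  refine Prod.ext (funext fun k => ?_) (by simpa using h4)
  exact eq_zero_of_circleCos_eq_one (by linarith [h3 k (Finset.mem_univ k)])

theorem bumpWeight_zero : bumpWeight 0 = 0 := by
  have : circleCos 0 = 1 := by simpa using circleCos_coe 0
  simp [bumpWeight, this]

theorem isCompact_bumpWeight_le (ε : ℝ) : IsCompact {p | bumpWeight p ≤ ε} := by
  refine (isCompact_univ.prod (isCompact_Icc (a := -(1 + ε)) (b := 1 + ε))).of_isClosed_subset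
    (isClosed_le continuous_bumpWeight continuous_const) fun p hp => ⟨mem_univ _, ?_⟩
  have h1 := sq_time_le_bumpWeight p
  have h2 : bumpWeight p ≤ ε := hp
  constructor <;> nlinarith [sq_nonneg (p.2 - 1), sq_nonneg (p.2 + 1)]

theorem hasDirDeriv_bumpWeight_space (k : Fin 3) :
    HasDirDeriv (spaceDir k) bumpWeight (fun p => 2 * Real.pi * circleSin (p.1 k)) := by
  intro p
  have h1 : ∀ j ∈ Finset.univ, HasDerivAt
      (fun h : ℝ => 1 - circleCos ((p + spaceDir k h).1 j))
      (if j = k then 2 * Real.pi * circleSin (p.1 k) else 0) 0 := by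
    intro j _
    split_ifs with hj
    · subst hj
      obtain ⟨x, hx⟩ := QuotientAddGroup.mk_surjective (p.1 j)
      have hx' : p.1 j = (x : UnitAddCircle) := hx.symm
      have h2 : ∀ h : ℝ, (p + spaceDir j h).1 j = ((x + h : ℝ) : UnitAddCircle) := fun h => by
        simp [spaceDir_apply, hx']
      simp only [h2, circleCos_coe]
      rw [hx', circleSin_coe]
      have h3 : HasDerivAt (fun h : ℝ => 2 * Real.pi * (x + h)) (2 * Real.pi) 0 := by
        simpa using ((hasDerivAt_id (0 : ℝ)).const_add x).const_mul (2 * Real.pi)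
      refine (h3.cos.const_sub 1).congr_deriv ?_
      simp
      ring
    · have h2 : ∀ h : ℝ, (p + spaceDir k h).1 j = p.1 j := fun h => by
        simp [spaceDir_apply, hj]
      simp only [h2]
      exact hasDerivAt_const _ _
  have h4 := (HasDerivAt.fun_sum h1).add_const (p.2 ^ 2)
  simp only [Finset.sum_ite_eq', Finset.mem_univ, if_true] at h4
  refine h4.congr_of_eventuallyEq (Eventually.of_forall fun h => ?_)
  simp [bumpWeight, spaceDir_apply]

theorem hasDirDeriv_bumpWeight_time :
    HasDirDeriv timeDir bumpWeight (fun p => 2 * p.2) := by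
  intro p
  have h1 : HasDerivAt (fun h : ℝ => (p.2 + h) ^ 2) (2 * p.2) 0 := by
    simpa using ((hasDerivAt_id (0 : ℝ)).const_add p.2).fun_pow 2
  refine (h1.const_add (∑ k, (1 - circleCos (p.1 k)))).congr_of_eventuallyEq
    (Eventually.of_forall fun h => ?_)
  simp [bumpWeight, timeDir_apply]

/-- A smooth nonnegative kernel of integral one with its space and time derivatives. -/
structure IsKernel (ρ : Torus3 × ℝ → ℝ) (ρx : Fin 3 → Torus3 × ℝ → ℝ) (ρt : Torus3 × ℝ → ℝ) :
    Prop where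
  nonneg : ∀ p, 0 ≤ ρ p
  integrable : Integrable ρ
  integral_eq_one : ∫ p, ρ p = 1
  continuous : Continuous ρ
  continuous_space : ∀ k, Continuous (ρx k)
  continuous_time : Continuous ρt
  bounded : ∃ M, ∀ p, |ρ p| ≤ M
  bounded_space : ∀ k, ∃ M, ∀ p, |ρx k p| ≤ M
  bounded_time : ∃ M, ∀ p, |ρt p| ≤ M
  deriv_space : ∀ k, HasDirDeriv (spaceDir k) ρ (ρx k)
  deriv_time : HasDirDeriv timeDir ρ ρt
  isTest : ∀ p, IsTest (fun q => ρ (p - q))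

theorem proj_surjective : Function.Surjective proj := by
  intro p
  choose x hx using fun k => QuotientAddGroup.mk_surjective (p.1 k)
  exact ⟨(x, p.2), Prod.ext (funext hx) rfl⟩

theorem contDiff_bumpWeight_proj :
    ContDiff ℝ ((⊤ : ℕ∞) : WithTop ℕ∞) (fun p => bumpWeight (proj p)) := by
  simp only [bumpWeight, proj, circleCos_coe]
  fun_prop

theorem exists_bounded_of_bumpWeight_support {f : Torus3 × ℝ → ℝ} {ε : ℝ} (hf : Continuous f)
    (h : ∀ p, ε < bumpWeight p → f p = 0) : ∃ M, ∀ p, |f p| ≤ M := by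
  have hs : HasCompactSupport f :=
    HasCompactSupport.intro (isCompact_bumpWeight_le ε) fun p hp => h p (not_le.1 hp)
  exact hs.exists_bound_of_continuous hf

/-- The kernel is a normalized smooth cutoff of `bumpWeight`. As a function on the group given by
cosines and `t²`, it needs no charts, and its derivatives come from the chain rule. -/
theorem exists_isKernel {ε : ℝ} (hε : 0 < ε) : ∃ ρ ρx ρt, IsKernel ρ ρx ρt ∧
    ∀ p, ε < bumpWeight p → ρ p = 0 := by
  set η : Torus3 × ℝ → ℝ := fun p => Real.smoothTransition (1 - bumpWeight p / ε) with hη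
  have hcd : ContDiff ℝ ((⊤ : ℕ∞) : WithTop ℕ∞) Real.smoothTransition :=
    Real.smoothTransition.contDiff
  have hη0 : ∀ p, 0 ≤ η p := fun p => Real.smoothTransition.nonneg _
  have hηc : Continuous η :=
    Real.smoothTransition.continuous.comp (by have := continuous_bumpWeight; fun_prop)
  have hηs : ∀ p, ε < bumpWeight p → η p = 0 := fun p hp =>
    Real.smoothTransition.zero_of_nonpos (by
      have : 1 < bumpWeight p / ε := (one_lt_div hε).2 hp
      linarith)
  have hηcs : HasCompactSupport η :=
    HasCompactSupport.intro (isCompact_bumpWeight_le ε) fun p hp => hηs p (not_le.1 hp)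
  have hηi : Integrable η := hηc.integrable_of_hasCompactSupport hηcs
  have hZ : 0 < ∫ p, η p := hηc.integral_pos_of_hasCompactSupport_nonneg_nonzero hηcs hη0
    (x := 0) (by simp [hη, bumpWeight_zero])
  set Z : ℝ := ∫ p, η p with hZdef
  set η' : Torus3 × ℝ → ℝ := fun p =>
    Z⁻¹ * (deriv Real.smoothTransition (1 - bumpWeight p / ε) * -ε⁻¹) with hη'
  have hη'c : Continuous η' := by
    have h1 : Continuous (deriv Real.smoothTransition) := hcd.continuous_deriv (by simp)
    have := continuous_bumpWeight
    fun_prop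
  have hη's : ∀ p, ε < bumpWeight p → η' p = 0 := fun p hp => by
    have h1 : 1 - bumpWeight p / ε < 0 := by
      have : 1 < bumpWeight p / ε := (one_lt_div hε).2 hp
      linarith
    have h2 : Real.smoothTransition =ᶠ[𝓝 (1 - bumpWeight p / ε)] fun _ => 0 := by
      filter_upwards [Iio_mem_nhds h1] with x hx
      exact Real.smoothTransition.zero_of_nonpos (le_of_lt hx)
    simp [hη', h2.deriv_eq]
  have hchain : ∀ {e : ℝ →+ Torus3 × ℝ} {w : Torus3 × ℝ → ℝ}, HasDirDeriv e bumpWeight w →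
      HasDirDeriv e (fun p => Z⁻¹ * η p) (fun p => η' p * w p) := by
    intro e w hw p
    have h1 : HasDerivAt Real.smoothTransition (deriv Real.smoothTransition
        (1 - bumpWeight p / ε)) (1 - bumpWeight (p + e 0) / ε) := by
      rw [map_zero, add_zero]
      exact ((hcd.differentiable (by simp)) _).hasDerivAt
    have h2 := (h1.comp 0 (((hw p).div_const ε).const_sub 1)).const_mul Z⁻¹
    refine h2.congr_deriv ?_
    simp only [hη']
    field_simp
  have hsin := continuous_circleSin
  refine ⟨fun p => Z⁻¹ * η p, fun k p => η' p * (2 * Real.pi * circleSin (p.1 k)),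
    fun p => η' p * (2 * p.2), ?_, fun p hp => by simp [hηs p hp]⟩
  have hcx : ∀ k : Fin 3, Continuous fun p : Torus3 × ℝ =>
      η' p * (2 * Real.pi * circleSin (p.1 k)) := fun k => by fun_prop
  have hct : Continuous fun p : Torus3 × ℝ => η' p * (2 * p.2) := by fun_prop
  refine ⟨fun p => mul_nonneg (inv_nonneg.2 hZ.le) (hη0 p), hηi.const_mul _, ?_, by fun_prop,
    hcx, hct, ?_, fun k => ?_, ?_, fun k => hchain (hasDirDeriv_bumpWeight_space k),
    hchain hasDirDeriv_bumpWeight_time, fun p => ⟨?_, ?_⟩⟩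
  · rw [integral_const_mul]
    exact inv_mul_cancel₀ hZ.ne'
  · exact exists_bounded_of_bumpWeight_support (by fun_prop) (ε := ε)
      fun p hp => by simp [hηs p hp]
  · exact exists_bounded_of_bumpWeight_support (hcx k) (ε := ε) fun p hp => by simp [hη's p hp]
  · exact exists_bounded_of_bumpWeight_support hct (ε := ε) fun p hp => by simp [hη's p hp]
  · obtain ⟨x, rfl⟩ := proj_surjective p
    have h1 : ContDiff ℝ ((⊤ : ℕ∞) : WithTop ℕ∞)
        fun q : (Fin 3 → ℝ) × ℝ => bumpWeight (proj (x - q)) :=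
      contDiff_bumpWeight_proj.comp (contDiff_const.sub contDiff_id)
    have h2 := hcd.comp (contDiff_const (c := (1 : ℝ)).sub (h1.div_const ε))
    exact contDiff_const.mul h2
  · exact (HasCompactSupport.mul_left (f := fun _ => Z⁻¹) hηcs).comp_homeomorph
      (Homeomorph.subLeft p)

/-- `bumpWeight` vanishes only at the origin and has compact sublevel sets, so away from an open
neighbourhood of the origin it has a positive minimum. -/
theorem eventually_bumpWeight_small {U : Set (Torus3 × ℝ)} (hU : U ∈ 𝓝 0) :
    ∃ ε > 0, ∀ p, bumpWeight p ≤ ε → p ∈ U := by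
  obtain ⟨V, hVU, hVo, h0V⟩ := mem_nhds_iff.1 hU
  have hK : IsCompact ({p | bumpWeight p ≤ 1} \ V) := (isCompact_bumpWeight_le 1).diff hVo
  rcases ({p | bumpWeight p ≤ 1} \ V).eq_empty_or_nonempty with he | hne
  · refine ⟨1, one_pos, fun p hp => ?_⟩
    by_contra hpU
    have : p ∈ ({p | bumpWeight p ≤ 1} \ V) := ⟨hp, fun h => hpU (hVU h)⟩
    simp [he] at this
  · obtain ⟨q, hq, hmin⟩ := hK.exists_isMinOn hne continuous_bumpWeight.continuousOn
    have hq0 : 0 < bumpWeight q := (bumpWeight_nonneg q).lt_of_ne fun h =>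
      hq.2 (eq_zero_of_bumpWeight_eq_zero h.symm ▸ h0V)
    refine ⟨min 1 (bumpWeight q / 2), lt_min one_pos (by positivity), fun p hp => ?_⟩
    by_contra hpU
    have h1 := hmin ⟨hp.trans (min_le_left _ _), fun h => hpU (hVU h)⟩
    have h2 := hp.trans (min_le_right _ _)
    have h3 : bumpWeight q ≤ bumpWeight p := h1
    linarith

/-- A sequence of kernels concentrating at the origin. -/
theorem exists_kernel_seq : ∃ (ρ : ℕ → Torus3 × ℝ → ℝ) (ρx : ℕ → Fin 3 → Torus3 × ℝ → ℝ)
    (ρt : ℕ → Torus3 × ℝ → ℝ), (∀ n, IsKernel (ρ n) (ρx n) (ρt n)) ∧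
    ∀ U ∈ 𝓝 (0 : Torus3 × ℝ), ∀ᶠ n in atTop, ∀ p, ρ n p ≠ 0 → p ∈ U := by
  choose ρ ρx ρt hk hs using fun n : ℕ => exists_isKernel (Nat.one_div_pos_of_nat (α := ℝ) (n := n))
  refine ⟨ρ, ρx, ρt, hk, fun U hU => ?_⟩
  obtain ⟨ε, hε, h⟩ := eventually_bumpWeight_small hU
  filter_upwards [(tendsto_one_div_add_atTop_nhds_zero_nat (𝕜 := ℝ)).eventually_lt_const hε]
    with n hn p hp
  refine h p (le_trans ?_ hn.le)
  by_contra hlt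
  exact hp (hs n p (not_le.1 hlt))

theorem timeDeriv_kernel {ρ ρt : Torus3 × ℝ → ℝ} (h : HasDirDeriv timeDir ρ ρt)
    (p q : Torus3 × ℝ) : timeDeriv (fun q => ρ (p - q)) q = -ρt (p - q) := by
  refine HasDerivAt.deriv ?_
  have h1 : HasDerivAt (fun s : ℝ => ρ (p - q + timeDir s)) (ρt (p - q)) (q.2 - q.2) := by
    simpa using h (p - q)
  refine (h1.comp_const_sub q.2 q.2).congr_of_eventuallyEq (Eventually.of_forall fun s => ?_)
  refine congrArg ρ (Prod.ext ?_ ?_) <;> simp [timeDir_apply]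

theorem spaceGrad_kernel {ρ ρx : Torus3 × ℝ → ℝ} {k : Fin 3} (h : HasDirDeriv (spaceDir k) ρ ρx)
    (p q : Torus3 × ℝ) : spaceGrad (fun q => ρ (p - q)) q k = -ρx (p - q) := by
  refine HasDerivAt.deriv ?_
  have h1 : HasDerivAt (fun s : ℝ => ρ (p - q + spaceDir k s)) (ρx (p - q)) (0 - 0) := by
    simpa using h (p - q)
  refine (h1.comp_const_sub 0 0).congr_of_eventuallyEq (Eventually.of_forall fun s => ?_)
  refine congrArg ρ (Prod.ext ?_ ?_)
  · simp only [spaceDir_apply, zero_sub, Prod.fst_sub, Prod.fst_add, AddCircle.coe_neg,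
      Pi.single_neg]
    abel
  · simp [spaceDir_apply]

/-! ### Smoothed conservation laws -/

/-- Restriction to `0 < t ≤ T`, extended by zero. -/
def trunc (T : ℝ) (f : Torus3 × ℝ → ℝ) : Torus3 × ℝ → ℝ :=
  (univ ×ˢ Ioc 0 T).indicator f

theorem trunc_of_mem {T : ℝ} {f : Torus3 × ℝ → ℝ} {p : Torus3 × ℝ} (h : 0 < p.2) (h' : p.2 ≤ T) :
    trunc T f p = f p := indicator_of_mem (show p ∈ univ ×ˢ Ioc 0 T from ⟨mem_univ _, h, h'⟩) f

theorem measurableSet_timeIoi : MeasurableSet (univ ×ˢ Ioi 0 : Set (Torus3 × ℝ)) :=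
  MeasurableSet.univ.prod measurableSet_Ioi

theorem measurableSet_timeIoc (T : ℝ) : MeasurableSet (univ ×ˢ Ioc 0 T : Set (Torus3 × ℝ)) :=
  MeasurableSet.univ.prod measurableSet_Ioc

theorem integral_stMeasure_eq {F : Torus3 × ℝ → ℝ} {T : ℝ} (h : ∀ q, T < q.2 → F q = 0) :
    ∫ q, F q ∂stMeasure = ∫ q, trunc T F q := by
  rw [stMeasure_eq, ← integral_indicator measurableSet_timeIoi]
  refine integral_congr_ae (Eventually.of_forall fun q => ?_)
  by_cases h0 : 0 < q.2
  · by_cases hT : q.2 ≤ T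
    · rw [trunc_of_mem h0 hT]
      exact indicator_of_mem (show q ∈ univ ×ˢ Ioi 0 from ⟨mem_univ _, h0⟩) F
    · have h1 : (univ ×ˢ Ioi 0 : Set (Torus3 × ℝ)).indicator F q = F q :=
        indicator_of_mem (show q ∈ univ ×ˢ Ioi 0 from ⟨mem_univ _, h0⟩) F
      have h2 : trunc T F q = 0 := indicator_of_notMem (fun hq => hT hq.2.2) F
      exact h1.trans ((h q (not_le.1 hT)).trans h2.symm)
  · have h1 : (univ ×ˢ Ioi 0 : Set (Torus3 × ℝ)).indicator F q = 0 :=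
      indicator_of_notMem (fun hq => h0 hq.2) F
    have h2 : trunc T F q = 0 := indicator_of_notMem (fun hq => h0 hq.2.1) F
    exact h1.trans h2.symm

theorem trunc_mul (T : ℝ) (f g : Torus3 × ℝ → ℝ) (q : Torus3 × ℝ) :
    trunc T (fun q => f q * g q) q = trunc T f q * g q := by
  by_cases h : q ∈ (univ ×ˢ Ioc 0 T : Set (Torus3 × ℝ)) <;> simp [trunc, indicator, h]

theorem ae_trunc {T : ℝ} {f : Torus3 × ℝ → ℝ} {P : ℝ → Prop} (h0 : P 0)
    (h : ∀ᵐ p ∂stMeasure, P (f p)) : ∀ᵐ p, P (trunc T f p) := by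
  rw [stMeasure_eq, ae_restrict_iff' measurableSet_timeIoi] at h
  filter_upwards [h] with p hp
  by_cases hm : p ∈ (univ ×ˢ Ioc 0 T : Set (Torus3 × ℝ))
  · rw [trunc, indicator_of_mem hm]
    exact hp ⟨mem_univ _, hm.2.1⟩
  · rw [trunc, indicator_of_notMem hm]
    exact h0

theorem integrable_trunc {T M : ℝ} {f : Torus3 × ℝ → ℝ} (hf : AEStronglyMeasurable f stMeasure)
    (hM : ∀ᵐ p ∂stMeasure, |f p| ≤ M) : Integrable (trunc T f) := by
  rw [trunc, integrable_indicator_iff (measurableSet_timeIoc T)]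
  have hle : (volume : Measure (Torus3 × ℝ)).restrict (univ ×ˢ Ioc 0 T) ≤ stMeasure := by
    rw [stMeasure_eq]
    exact Measure.restrict_mono (prod_mono subset_rfl fun t ht => ht.1) le_rfl
  have hfin : (volume : Measure (Torus3 × ℝ)) (univ ×ˢ Ioc 0 T) ≠ ⊤ := by
    rw [Measure.volume_eq_prod, Measure.prod_prod]
    simp
  have : IsFiniteMeasure ((volume : Measure (Torus3 × ℝ)).restrict (univ ×ˢ Ioc 0 T)) :=
    ⟨by simpa using hfin.lt_top⟩
  exact Integrable.of_bound (hf.mono_measure hle) M (ae_mono hle hM)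

theorem mollify_nonneg {f ρ : Torus3 × ℝ → ℝ} (hf : ∀ᵐ p, 0 ≤ f p) (hρ : ∀ p, 0 ≤ ρ p)
    (p : Torus3 × ℝ) : 0 ≤ mollify volume f ρ p :=
  integral_nonneg_of_ae (hf.mono fun _ hq => mul_nonneg hq (hρ _))

theorem IsKernel.abs_mollify_le {ρ : Torus3 × ℝ → ℝ} {ρx : Fin 3 → Torus3 × ℝ → ℝ}
    {ρt : Torus3 × ℝ → ℝ} (hρ : IsKernel ρ ρx ρt) {f : Torus3 × ℝ → ℝ} {M : ℝ}
    (hM : ∀ᵐ p, |f p| ≤ M) (p : Torus3 × ℝ) : |mollify volume f ρ p| ≤ M := by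
  have h1 : ∫ q, M * ρ (p - q) = M := by
    rw [integral_const_mul, integral_sub_left_eq_self (E := ℝ) ρ volume p, hρ.integral_eq_one, mul_one]
  rw [← h1, ← Real.norm_eq_abs, mollify]
  refine norm_integral_le_of_norm_le ((hρ.integrable.comp_sub_left p).const_mul M) ?_
  filter_upwards [hM] with q hq
  rw [Real.norm_eq_abs, abs_mul, abs_of_nonneg (hρ.nonneg _)]
  exact mul_le_mul_of_nonneg_right hq (hρ.nonneg _)

/-- A concentration `c` with bounded gradient `g` and bounded flux `J` solving
`∂ₜ c + ∇ · J = 0` in the sense of distributions on `𝕋³ × (0,∞)`. -/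
structure IsBoundedFlow (M : ℝ) (c : Torus3 × ℝ → ℝ) (J g : Torus3 × ℝ → E3) : Prop where
  measurable : AEStronglyMeasurable c stMeasure
  measurable_flux : ∀ k, AEStronglyMeasurable (fun p => J p k) stMeasure
  measurable_grad : ∀ k, AEStronglyMeasurable (fun p => g p k) stMeasure
  bounds : ∀ᵐ p ∂stMeasure, 0 ≤ c p ∧ c p ≤ 1
  flux_le : ∀ k, ∀ᵐ p ∂stMeasure, |J p k| ≤ M
  grad_le : ∀ k, ∀ᵐ p ∂stMeasure, |g p k| ≤ M
  weakGrad : IsWeakGrad c g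
  continuity : ∀ φ : Torus3 × ℝ → ℝ, IsTest φ → tsupport φ ⊆ univ ×ˢ Ioi (0 : ℝ) →
    ∫ p, c p * timeDeriv φ p ∂stMeasure + ∫ p, inner ℝ (J p) (spaceGrad φ p) ∂stMeasure = 0

theorem IsBoundedFlow.abs_le {M : ℝ} {c : Torus3 × ℝ → ℝ} {J g : Torus3 × ℝ → E3}
    (h : IsBoundedFlow M c J g) : ∀ᵐ p ∂stMeasure, |c p| ≤ 1 :=
  h.bounds.mono fun p hp => by rw [abs_of_nonneg hp.1]; exact hp.2

/-- A direction `e` that moves time by at most `|s|` stays, for small `s`, in the open region `r <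
|t|` where `ρ` vanishes. -/
theorem dirDeriv_eq_zero_of_support {e : ℝ →+ Torus3 × ℝ} (he : ∀ s, |(e s).2| ≤ |s|)
    {ρ ρ' : Torus3 × ℝ → ℝ} (h : HasDirDeriv e ρ ρ') {r : ℝ} (hr : ∀ p, ρ p ≠ 0 → |p.2| ≤ r)
    {p : Torus3 × ℝ} (hp : r < |p.2|) : ρ' p = 0 := by
  have h1 : (fun s : ℝ => ρ (p + e s)) =ᶠ[𝓝 0] fun _ => 0 := by
    filter_upwards [Metric.ball_mem_nhds (0 : ℝ) (sub_pos.2 hp)] with s hs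
    by_contra hne
    have h2 := hr _ hne
    have h3 := he s
    rw [mem_ball_zero_iff, Real.norm_eq_abs] at hs
    have h4 : |p.2| ≤ |(p + e s).2| + |(e s).2| := by
      have : p.2 = (p + e s).2 - (e s).2 := by simp
      rw [this]
      exact abs_sub _ _
    linarith
  exact (h p).unique ((hasDerivAt_const (0 : ℝ) (0 : ℝ)).congr_of_eventuallyEq h1)

theorem abs_spaceDir_snd_le (k : Fin 3) (s : ℝ) : |(spaceDir k s).2| ≤ |s| := by
  simp [spaceDir_apply]

theorem abs_timeDir_snd_le (s : ℝ) : |(timeDir s).2| ≤ |s| := by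
  simp [timeDir_apply]

section Smoothed

variable {ρ : Torus3 × ℝ → ℝ} {ρx : Fin 3 → Torus3 × ℝ → ℝ} {ρt : Torus3 × ℝ → ℝ} {r T : ℝ}

/-- The kernel centred at `p` does not see times after `p.2 + r`, so the truncation at `T`, which
provides integrability, changes nothing. -/
theorem integral_mul_kernel_eq_mollify {σ : Torus3 × ℝ → ℝ} (hr : ∀ p, r < |p.2| → σ p = 0)
    {p : Torus3 × ℝ} (hp' : p.2 + r < T) (f : Torus3 × ℝ → ℝ) :
    ∫ q, f q * σ (p - q) ∂stMeasure = mollify volume (trunc T f) σ p := by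
  rw [integral_stMeasure_eq (T := T), mollify]
  · simp only [trunc_mul]
  · intro q hq
    rw [hr, mul_zero]
    rw [Prod.snd_sub, lt_abs]
    right
    linarith

theorem tsupport_kernel_subset (hr : ∀ p, ρ p ≠ 0 → |p.2| ≤ r)
    {p : Torus3 × ℝ} (hp : r < p.2) : tsupport (fun q => ρ (p - q)) ⊆ univ ×ˢ Ioi (0 : ℝ) := by
  have h1 : tsupport (fun q => ρ (p - q)) ⊆ {q | |(p - q).2| ≤ r} :=
    closure_minimal (fun q hq => hr _ hq) (isClosed_le (by fun_prop) continuous_const)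
  intro q hq
  have h2 : |p.2 - q.2| ≤ r := h1 hq
  have h3 := (abs_le.1 h2).2
  refine ⟨mem_univ _, ?_⟩
  simp only [mem_Ioi]
  linarith

/-- The function `q ↦ ρ (p - q)` is an admissible test function for the weak gradient as soon as its
support stays in positive times. The sign from reflecting the kernel cancels the one from
integration by parts. -/
theorem IsKernel.mollify_grad (hρ : IsKernel ρ ρx ρt) (hr : ∀ p, ρ p ≠ 0 → |p.2| ≤ r)
    {c : Torus3 × ℝ → ℝ} {g : Torus3 × ℝ → E3} (h : IsWeakGrad c g) {p : Torus3 × ℝ}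
    (hp : r < p.2) (hp' : p.2 + r < T) (k : Fin 3) :
    mollify volume (trunc T c) (ρx k) p = mollify volume (trunc T (fun q => g q k)) ρ p := by
  have h1 := h.byParts _ (hρ.isTest p) (tsupport_kernel_subset hr hp) k
  simp only [spaceGrad_kernel (hρ.deriv_space k), mul_neg, integral_neg, neg_inj] at h1
  rw [← integral_mul_kernel_eq_mollify (r := r) ?_ hp', h1, integral_mul_kernel_eq_mollify ?_ hp']
  · exact fun q hq => by_contra fun hne => absurd (hr q hne) (not_le.2 hq)
  · exact fun q hq => dirDeriv_eq_zero_of_support (abs_spaceDir_snd_le k) (hρ.deriv_space k) hr hq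

/-- The same test function in the continuity equation: away from the ends of the time interval, the
smoothed concentration and flux satisfy the equation classically. -/
theorem IsKernel.mollify_continuity (hρ : IsKernel ρ ρx ρt) (hr : ∀ p, ρ p ≠ 0 → |p.2| ≤ r)
    {M : ℝ} {c : Torus3 × ℝ → ℝ} {J g : Torus3 × ℝ → E3} (h : IsBoundedFlow M c J g)
    {p : Torus3 × ℝ} (hp : r < p.2) (hp' : p.2 + r < T) :
    mollify volume (trunc T c) ρt p =
      - ∑ k, mollify volume (trunc T (fun q => J q k)) (ρx k) p := by
  have h1 := h.continuity _ (hρ.isTest p) (tsupport_kernel_subset hr hp)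
  have hin : ∀ q, inner ℝ (J q) (spaceGrad (fun q => ρ (p - q)) q) =
      ∑ k, -(J q k * ρx k (p - q)) := by
    intro q
    simp only [PiLp.inner_apply, spaceGrad_kernel (hρ.deriv_space _)]
    simp [mul_comm]
  have ht0 : ∀ q : Torus3 × ℝ, r < |q.2| → ρt q = 0 := fun q hq =>
    dirDeriv_eq_zero_of_support abs_timeDir_snd_le hρ.deriv_time hr hq
  have hx0 : ∀ k, ∀ q : Torus3 × ℝ, r < |q.2| → ρx k q = 0 := fun k q hq =>
    dirDeriv_eq_zero_of_support (abs_spaceDir_snd_le k) (hρ.deriv_space k) hr hq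
  have hint : ∀ k, Integrable (fun q => J q k * ρx k (p - q)) stMeasure := by
    intro k
    obtain ⟨B, hB⟩ := hρ.bounded_space k
    have h2 := integrable_mul_shift (integrable_trunc (T := T) (h.measurable_flux k) (h.flux_le k))
      (hρ.continuous_space k) hB p
    rw [stMeasure_eq, ← IntegrableOn, ← integrable_indicator_iff measurableSet_timeIoi]
    refine h2.congr (Eventually.of_forall fun q => ?_)
    by_cases hq : p.2 - q.2 < -r
    · have h3 : ρx k (p - q) = 0 := hx0 k _ (by rw [Prod.snd_sub, lt_abs]; right; linarith)
      simp [indicator, h3]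
    · by_cases h0 : 0 < q.2
      · have h4 : trunc T (fun q => J q k) q = J q k := trunc_of_mem h0 (by linarith)
        have h5 : q ∈ (univ ×ˢ Ioi 0 : Set (Torus3 × ℝ)) := ⟨mem_univ _, h0⟩
        simp only [h4, indicator_of_mem h5]
      · have h4 : trunc T (fun q => J q k) q = 0 := indicator_of_notMem (fun hq => h0 hq.2.1) _
        have h5 : q ∉ (univ ×ˢ Ioi 0 : Set (Torus3 × ℝ)) := fun hq => h0 hq.2
        simp only [h4, indicator_of_notMem h5, zero_mul]
  simp only [timeDeriv_kernel hρ.deriv_time, hin, mul_neg, integral_neg] at h1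
  rw [integral_finsetSum _ fun k _ => (hint k).fun_neg] at h1
  simp only [integral_neg] at h1
  rw [integral_mul_kernel_eq_mollify ht0 hp'] at h1
  simp only [fun k => integral_mul_kernel_eq_mollify (hx0 k) hp' (fun q => J q k)] at h1
  rw [Finset.sum_neg_distrib] at h1
  linarith

end Smoothed

/-- A common subsequence along which finitely many convolutions converge almost everywhere. -/
theorem exists_seq_tendsto_mollify {ι : Type*} [Fintype ι] {f : ι → Torus3 × ℝ → ℝ}
    (hf : ∀ i, Integrable (f i)) {ρ : ℕ → Torus3 × ℝ → ℝ} {ρx : ℕ → Fin 3 → Torus3 × ℝ → ℝ}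
    {ρt : ℕ → Torus3 × ℝ → ℝ} (hρ : ∀ n, IsKernel (ρ n) (ρx n) (ρt n))
    (hρs : ∀ U ∈ 𝓝 (0 : Torus3 × ℝ), ∀ᶠ n in atTop, ∀ p, ρ n p ≠ 0 → p ∈ U) :
    ∃ ns : ℕ → ℕ, StrictMono ns ∧ ∀ᵐ p, ∀ i,
      Tendsto (fun n => mollify volume (f i) (ρ (ns n)) p) atTop (𝓝 (f i p)) := by
  have hm : ∀ n i, AEStronglyMeasurable (mollify volume (f i) (ρ n) - f i)
      (volume : Measure (Torus3 × ℝ)) := fun n i => by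
    obtain ⟨B, hB⟩ := (hρ n).bounded
    exact (continuous_mollify (hf i) (hρ n).continuous hB).aestronglyMeasurable.sub
      (hf i).aestronglyMeasurable
  -- Summing the errors over `i` yields one subsequence that serves every `f i`.
  set g : ℕ → Torus3 × ℝ → ℝ := fun n => ∑ i, fun p => ‖(mollify volume (f i) (ρ n) - f i) p‖ with hg
  have hgm : ∀ n, AEStronglyMeasurable (g n) (volume : Measure (Torus3 × ℝ)) := fun n =>
    Finset.aestronglyMeasurable_sum _ fun i _ => (hm n i).norm
  have hgt : Tendsto (fun n => eLpNorm (g n - 0) 1 volume) atTop (𝓝 0) := by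
    have h1 : Tendsto (fun n => ∑ i, eLpNorm (mollify volume (f i) (ρ n) - f i) 1 volume) atTop
        (𝓝 (∑ _i : ι, 0)) := tendsto_finsetSum _ fun i _ =>
      tendsto_eLpNorm_mollify (hf i) (fun n => (hρ n).continuous) (fun n => (hρ n).nonneg)
        (fun n => (hρ n).integrable) (fun n => (hρ n).integral_eq_one) hρs
    rw [Finset.sum_const_zero] at h1
    refine tendsto_of_tendsto_of_tendsto_of_le_of_le tendsto_const_nhds h1 (fun _ => zero_le)
      fun n => ?_
    rw [sub_zero]
    refine (eLpNorm_sum_le (fun i _ => (hm n i).norm) le_rfl).trans (le_of_eq ?_)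
    exact Finset.sum_congr rfl fun i _ => eLpNorm_norm _
  obtain ⟨ns, hns, hae⟩ := (tendstoInMeasure_of_tendsto_eLpNorm one_ne_zero hgm
    aestronglyMeasurable_const hgt).exists_seq_tendsto_ae
  refine ⟨ns, hns, hae.mono fun p hp i => ?_⟩
  rw [tendsto_iff_norm_sub_tendsto_zero]
  refine squeeze_zero (fun _ => norm_nonneg _) (fun n => ?_) hp
  simp only [hg, Finset.sum_apply]
  exact Finset.single_le_sum (f := fun i => ‖(mollify volume (f i) (ρ (ns n)) - f i) p‖)
    (fun i _ => norm_nonneg _) (Finset.mem_univ i)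

/-! ### The localized energy identity -/

theorem hasCompactSupport_of_slab {g : Torus3 × ℝ → ℝ} {a b : ℝ}
    (h0 : ∀ p, p.2 ∉ Icc a b → g p = 0) : HasCompactSupport g :=
  HasCompactSupport.intro (isCompact_univ.prod (isCompact_Icc (a := a) (b := b))) fun p hp =>
    h0 p fun h => hp ⟨mem_univ _, h⟩

theorem integral_dirDeriv_slab {e : ℝ →+ Torus3 × ℝ} (he : ∀ s, |(e s).2| ≤ |s|)
    {g g' : Torus3 × ℝ → ℝ} (h : HasDirDeriv e g g') (hg : Continuous g) (hg' : Continuous g')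
    {a b : ℝ} (h0 : ∀ p, p.2 ∉ Icc a b → g p = 0) (h0' : ∀ p, p.2 ∉ Icc a b → g' p = 0) :
    ∫ p, g' p = 0 := by
  obtain ⟨M, hM⟩ := (hasCompactSupport_of_slab h0').exists_bound_of_continuous hg'
  -- The slab is widened by 1 to dominate the derivative along all shifts with `|s| < 1`.
  have hK : IsCompact (univ ×ˢ Icc (a - 1) (b + 1) : Set (Torus3 × ℝ)) :=
    isCompact_univ.prod isCompact_Icc
  refine integral_dirDeriv_eq_zero h (hg.integrable_of_hasCompactSupport
    (hasCompactSupport_of_slab h0)) hg'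
    (bound := (univ ×ˢ Icc (a - 1) (b + 1)).indicator fun _ => M) ?_ fun p s hs => ?_
  · rw [integrable_indicator_iff hK.measurableSet]
    exact integrableOn_const hK.measure_lt_top.ne
  · by_cases hp : p ∈ (univ ×ˢ Icc (a - 1) (b + 1) : Set (Torus3 × ℝ))
    · rw [indicator_of_mem hp]
      exact hM _
    · rw [indicator_of_notMem hp, h0', abs_zero]
      intro hmem
      have h1 := abs_le.1 ((he s).trans hs.le)
      rw [Prod.snd_add] at hmem
      exact hp ⟨mem_univ _, by linarith [hmem.1], by linarith [hmem.2]⟩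

theorem hasDirDeriv_energy {e : ℝ →+ Torus3 × ℝ} {A B A' B' : Torus3 × ℝ → ℝ} {δ : ℝ}
    (hδ : 0 < δ) (hB0 : ∀ p, 0 ≤ B p) (hA : HasDirDeriv e A A') (hB : HasDirDeriv e B B') :
    HasDirDeriv e (fun p => (A p - B p) ^ 2 / (B p + δ)) (fun p =>
      2 * (A p - B p) / (B p + δ) * A' p +
        (-(2 * (A p - B p) / (B p + δ)) - (A p - B p) ^ 2 / (B p + δ) ^ 2) * B' p) := by
  intro p
  have hγ : 0 < B p + δ := by have := hB0 p; positivity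
  have h1 := (((hA p).fun_sub (hB p)).fun_pow 2).fun_div ((hB p).add_const δ) (by simpa using hγ.ne')
  simp only [map_zero, add_zero] at h1
  refine h1.congr_deriv ?_
  field_simp
  simp
  ring

/-- The differentiated product is the flux of the energy density. Its derivative is `energyRate`
plus the terms with `∂ₖJ`; summed over `k`, the latter cancel the time derivative in
`hasDirDeriv_energy` by the continuity equations. -/
theorem hasDirDeriv_energyFlux {e : ℝ →+ Torus3 × ℝ} {A B JA JB A' B' JA' JB' : Torus3 × ℝ → ℝ}
    {δ : ℝ} (hδ : 0 < δ) (hB0 : ∀ p, 0 ≤ B p) (hA : HasDirDeriv e A A') (hB : HasDirDeriv e B B')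
    (hJA : HasDirDeriv e JA JA') (hJB : HasDirDeriv e JB JB') :
    HasDirDeriv e (fun p => 2 * (A p - B p) / (B p + δ) * JA p +
        (-(2 * (A p - B p) / (B p + δ)) - (A p - B p) ^ 2 / (B p + δ) ^ 2) * JB p) (fun p =>
      energyRate δ (A p) (B p) (JA p) (JB p) (A' p) (B' p) +
      (2 * (A p - B p) / (B p + δ) * JA' p +
        (-(2 * (A p - B p) / (B p + δ)) - (A p - B p) ^ 2 / (B p + δ) ^ 2) * JB' p)) := by
  intro p
  have hγ : 0 < B p + δ := by have := hB0 p; positivity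
  have hγ' : B (p + e 0) + δ ≠ 0 := by simpa using hγ.ne'
  have hBδ := (hB p).add_const δ
  have h1 := (((hA p).fun_sub (hB p)).const_mul 2).fun_div hBδ hγ'
  have h2 := (((hA p).fun_sub (hB p)).fun_pow 2).fun_div (hBδ.fun_pow 2) (pow_ne_zero 2 hγ')
  have h3 := (h1.fun_mul (hJA p)).fun_add ((h1.fun_neg.fun_sub h2).fun_mul (hJB p))
  simp only [map_zero, add_zero] at h3
  refine h3.congr_deriv ?_
  simp only [energyRate]
  field_simp
  simp
  ring

theorem hasDirDeriv_time_of_space {θ : ℝ → ℝ} (k : Fin 3) :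
    HasDirDeriv (spaceDir k) (fun p => θ p.2) (fun _ => 0) := fun p => by
  simpa [spaceDir_apply] using hasDerivAt_const (0 : ℝ) (θ p.2)

theorem hasDirDeriv_time {θ θ' : ℝ → ℝ} (h : ∀ t, HasDerivAt θ (θ' t) t) :
    HasDirDeriv timeDir (fun p => θ p.2) (fun p => θ' p.2) := fun p => by
  have h1 : HasDerivAt θ (θ' p.2) (p.2 + 0) := by simpa using h p.2
  exact h1.comp_const_add p.2 0

/-- For smoothed flows the integrand is a full space-time divergence: the time derivative of `θ`
times the energy, plus the space derivatives of `θ` times its flux. The condition on `r` keeps the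
support of `θ` where the smoothed equations hold. -/
theorem integral_mollified_energy {M : ℝ} {c c' : Torus3 × ℝ → ℝ} {J J' g g' : Torus3 × ℝ → E3}
    (h : IsBoundedFlow M c J g) (h' : IsBoundedFlow M c' J' g') {δ : ℝ} (hδ : 0 < δ)
    {θ θ' : ℝ → ℝ} (hθ : ∀ t, HasDerivAt θ (θ' t) t) (hθ'c : Continuous θ') {a b r T : ℝ}
    (hra : r < a) (hbT : b + r < T) (hθ0 : ∀ t ∉ Icc a b, θ t = 0) (hθ'0 : ∀ t ∉ Icc a b, θ' t = 0)
    {ρ : Torus3 × ℝ → ℝ} {ρx : Fin 3 → Torus3 × ℝ → ℝ} {ρt : Torus3 × ℝ → ℝ}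
    (hρ : IsKernel ρ ρx ρt) (hr : ∀ p, ρ p ≠ 0 → |p.2| ≤ r) :
    ∫ p, (θ' p.2 * ((mollify volume (trunc T c) ρ p - mollify volume (trunc T c') ρ p) ^ 2 /
        (mollify volume (trunc T c') ρ p + δ)) +
      θ p.2 * ∑ k, energyRate δ (mollify volume (trunc T c) ρ p) (mollify volume (trunc T c') ρ p)
        (mollify volume (trunc T fun q => J q k) ρ p) (mollify volume (trunc T fun q => J' q k) ρ p)
        (mollify volume (trunc T fun q => g q k) ρ p)
        (mollify volume (trunc T fun q => g' q k) ρ p)) = 0 := by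
  obtain ⟨Mρ, hMρ⟩ := hρ.bounded
  obtain ⟨Mt, hMt⟩ := hρ.bounded_time
  choose Mx hMx using hρ.bounded_space
  have ic : Integrable (trunc T c) := integrable_trunc h.measurable h.abs_le
  have ic' : Integrable (trunc T c') := integrable_trunc h'.measurable h'.abs_le
  have iJ : ∀ k, Integrable (trunc T fun q => J q k) := fun k =>
    integrable_trunc (h.measurable_flux k) (h.flux_le k)
  have iJ' : ∀ k, Integrable (trunc T fun q => J' q k) := fun k =>
    integrable_trunc (h'.measurable_flux k) (h'.flux_le k)
  set A := mollify volume (trunc T c) ρ with hA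
  set B := mollify volume (trunc T c') ρ with hB
  set JA : Fin 3 → Torus3 × ℝ → ℝ := fun k => mollify volume (trunc T fun q => J q k) ρ with hJA
  set JB : Fin 3 → Torus3 × ℝ → ℝ := fun k => mollify volume (trunc T fun q => J' q k) ρ with hJB
  set At := mollify volume (trunc T c) ρt with hAt
  set Bt := mollify volume (trunc T c') ρt with hBt
  set Ax : Fin 3 → Torus3 × ℝ → ℝ := fun k => mollify volume (trunc T c) (ρx k) with hAx
  set Bx : Fin 3 → Torus3 × ℝ → ℝ := fun k => mollify volume (trunc T c') (ρx k) with hBx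
  set JAx : Fin 3 → Torus3 × ℝ → ℝ := fun k => mollify volume (trunc T fun q => J q k) (ρx k)
    with hJAx
  set JBx : Fin 3 → Torus3 × ℝ → ℝ := fun k => mollify volume (trunc T fun q => J' q k) (ρx k)
    with hJBx
  have cA : Continuous A := continuous_mollify ic hρ.continuous hMρ
  have cB : Continuous B := continuous_mollify ic' hρ.continuous hMρ
  have cJA : ∀ k, Continuous (JA k) := fun k => continuous_mollify (iJ k) hρ.continuous hMρ
  have cJB : ∀ k, Continuous (JB k) := fun k => continuous_mollify (iJ' k) hρ.continuous hMρ
  have cAt : Continuous At := continuous_mollify ic hρ.continuous_time hMt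
  have cBt : Continuous Bt := continuous_mollify ic' hρ.continuous_time hMt
  have cAx : ∀ k, Continuous (Ax k) := fun k =>
    continuous_mollify ic (hρ.continuous_space k) (hMx k)
  have cBx : ∀ k, Continuous (Bx k) := fun k =>
    continuous_mollify ic' (hρ.continuous_space k) (hMx k)
  have cJAx : ∀ k, Continuous (JAx k) := fun k =>
    continuous_mollify (iJ k) (hρ.continuous_space k) (hMx k)
  have cJBx : ∀ k, Continuous (JBx k) := fun k =>
    continuous_mollify (iJ' k) (hρ.continuous_space k) (hMx k)
  have dAt : HasDirDeriv timeDir A At :=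
    hasDirDeriv_mollify ic hρ.continuous hρ.continuous_time hMρ hMt hρ.deriv_time
  have dBt : HasDirDeriv timeDir B Bt :=
    hasDirDeriv_mollify ic' hρ.continuous hρ.continuous_time hMρ hMt hρ.deriv_time
  have dAx : ∀ k, HasDirDeriv (spaceDir k) A (Ax k) := fun k =>
    hasDirDeriv_mollify ic hρ.continuous (hρ.continuous_space k) hMρ (hMx k) (hρ.deriv_space k)
  have dBx : ∀ k, HasDirDeriv (spaceDir k) B (Bx k) := fun k =>
    hasDirDeriv_mollify ic' hρ.continuous (hρ.continuous_space k) hMρ (hMx k) (hρ.deriv_space k)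
  have dJAx : ∀ k, HasDirDeriv (spaceDir k) (JA k) (JAx k) := fun k =>
    hasDirDeriv_mollify (iJ k) hρ.continuous (hρ.continuous_space k) hMρ (hMx k) (hρ.deriv_space k)
  have dJBx : ∀ k, HasDirDeriv (spaceDir k) (JB k) (JBx k) := fun k =>
    hasDirDeriv_mollify (iJ' k) hρ.continuous (hρ.continuous_space k) hMρ (hMx k) (hρ.deriv_space k)
  have B0 : ∀ p, 0 ≤ B p :=
    mollify_nonneg (ae_trunc le_rfl (h'.bounds.mono fun _ hp => hp.1)) hρ.nonneg
  have hγ : ∀ p, B p + δ ≠ 0 := fun p => (add_pos_of_nonneg_of_pos (B0 p) hδ).ne'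
  have cθ : Continuous θ := continuous_iff_continuousAt.2 fun t => (hθ t).continuousAt
  have cF1 : Continuous fun p => 2 * (A p - B p) / (B p + δ) := by fun_prop (disch := exact hγ _)
  have cF2 : Continuous fun p => -(2 * (A p - B p) / (B p + δ)) -
      (A p - B p) ^ 2 / (B p + δ) ^ 2 :=
    cF1.neg.sub (Continuous.div (by fun_prop) (by fun_prop) fun p => pow_ne_zero _ (hγ p))
  have cF : Continuous fun p => (A p - B p) ^ 2 / (B p + δ) := by fun_prop (disch := exact hγ _)
  have cR : ∀ k, Continuous fun p =>
      energyRate δ (A p) (B p) (JA k p) (JB k p) (Ax k p) (Bx k p) := fun k => by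
    have := cJA k; have := cJB k; have := cAx k; have := cBx k
    unfold energyRate
    have c1 : Continuous fun p => 2 * (JA k p - JB k p) * (Ax k p - Bx k p) / (B p + δ) := by
      fun_prop (disch := exact hγ _)
    have c2 : Continuous fun p => 2 * (A p - B p) / (B p + δ) ^ 2 :=
      Continuous.div (by fun_prop) (by fun_prop) fun p => pow_ne_zero _ (hγ p)
    have c3 : Continuous fun p => 2 * (A p - B p) ^ 2 / (B p + δ) ^ 3 :=
      Continuous.div (by fun_prop) (by fun_prop) fun p => pow_ne_zero _ (hγ p)
    fun_prop
  have ht := integral_dirDeriv_slab abs_timeDir_snd_le (a := a) (b := b)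
    ((hasDirDeriv_time hθ).mul (hasDirDeriv_energy hδ B0 dAt dBt)) (by fun_prop) (by fun_prop)
    (fun p hp => by simp [hθ0 _ hp]) (fun p hp => by simp [hθ0 _ hp, hθ'0 _ hp])
  have it := Continuous.integrable_of_hasCompactSupport (μ := (volume : Measure (Torus3 × ℝ)))
    (f := fun p => θ' p.2 * ((A p - B p) ^ 2 / (B p + δ)) + θ p.2 *
      (2 * (A p - B p) / (B p + δ) * At p +
        (-(2 * (A p - B p) / (B p + δ)) - (A p - B p) ^ 2 / (B p + δ) ^ 2) * Bt p))
    (by fun_prop) (hasCompactSupport_of_slab (a := a) (b := b)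
      fun p hp => by simp [hθ0 _ hp, hθ'0 _ hp])
  -- The factor `0` is the space derivative of `θ`, kept so that the expression matches
  -- `HasDirDeriv.mul`.
  set S : Fin 3 → Torus3 × ℝ → ℝ := fun k p => 0 * (2 * (A p - B p) / (B p + δ) * JA k p +
        (-(2 * (A p - B p) / (B p + δ)) - (A p - B p) ^ 2 / (B p + δ) ^ 2) * JB k p) + θ p.2 *
      (energyRate δ (A p) (B p) (JA k p) (JB k p) (Ax k p) (Bx k p) +
      (2 * (A p - B p) / (B p + δ) * JAx k p +
        (-(2 * (A p - B p) / (B p + δ)) - (A p - B p) ^ 2 / (B p + δ) ^ 2) * JBx k p)) with hS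
  have cS : ∀ k, Continuous (S k) := fun k => by
    have := cJA k; have := cJB k; have := cJAx k; have := cJBx k; have := cR k
    simp only [hS]
    fun_prop
  have hx : ∀ k, ∫ p, S k p = 0 := fun k => by
    have := cJA k; have := cJB k
    exact integral_dirDeriv_slab (abs_spaceDir_snd_le k) (a := a) (b := b)
      ((hasDirDeriv_time_of_space k).mul
        (hasDirDeriv_energyFlux hδ B0 (dAx k) (dBx k) (dJAx k) (dJBx k))) (by fun_prop) (cS k)
      (fun p hp => by simp [hθ0 _ hp]) (fun p hp => by simp [hS, hθ0 _ hp])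
  have ix : ∀ k, Integrable (S k) := fun k =>
    (cS k).integrable_of_hasCompactSupport (hasCompactSupport_of_slab (a := a) (b := b)
      fun p hp => by simp [hS, hθ0 _ hp])
  have hsum := integral_add it (integrable_finsetSum Finset.univ fun k _ => ix k)
  rw [ht, integral_finsetSum _ fun k _ => ix k, Finset.sum_eq_zero fun k _ => hx k, add_zero] at hsum
  rw [← hsum]
  refine integral_congr_ae (Eventually.of_forall fun p => ?_)
  by_cases hp : p.2 ∈ Icc a b
  · have hp1 : r < p.2 := hra.trans_le hp.1
    have hp2 : p.2 + r < T := by linarith [hp.2]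
    have e1 : At p = - ∑ k, JAx k p := hρ.mollify_continuity hr h hp1 hp2
    have e2 : Bt p = - ∑ k, JBx k p := hρ.mollify_continuity hr h' hp1 hp2
    have e3 : ∀ k, mollify volume (trunc T fun q => g q k) ρ p = Ax k p := fun k =>
      (hρ.mollify_grad hr h.weakGrad hp1 hp2 k).symm
    have e4 : ∀ k, mollify volume (trunc T fun q => g' q k) ρ p = Bx k p := fun k =>
      (hρ.mollify_grad hr h'.weakGrad hp1 hp2 k).symm
    simp only [e1, e2, e3, e4, hS, Fin.sum_univ_three]
    ring
  · simp [hS, hθ0 _ hp, hθ'0 _ hp]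

/-! ### Removal of the smoothing in the energy identity -/

theorem continuousOn_energyRate {δ : ℝ} (hδ : 0 < δ) :
    ContinuousOn (fun z : ℝ × ℝ × ℝ × ℝ × ℝ × ℝ =>
      energyRate δ z.1 z.2.1 z.2.2.1 z.2.2.2.1 z.2.2.2.2.1 z.2.2.2.2.2) {z | 0 ≤ z.2.1} := by
  have hγ : ∀ z ∈ {z : ℝ × ℝ × ℝ × ℝ × ℝ × ℝ | 0 ≤ z.2.1}, z.2.1 + δ ≠ 0 := fun z hz =>
    (add_pos_of_nonneg_of_pos hz hδ).ne'
  unfold energyRate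
  refine ContinuousOn.add (ContinuousOn.sub ?_ (ContinuousOn.mul ?_ (by fun_prop)))
    (ContinuousOn.mul ?_ (by fun_prop))
  · exact ContinuousOn.div (by fun_prop) (by fun_prop) hγ
  · exact ContinuousOn.div (by fun_prop) (by fun_prop) fun z hz => pow_ne_zero _ (hγ z hz)
  · exact ContinuousOn.div (by fun_prop) (by fun_prop) fun z hz => pow_ne_zero _ (hγ z hz)

/-- The dominating constant for the limit: smoothing preserves the bounds on concentrations, fluxes
and gradients, so all arguments stay in one compact set. -/
theorem exists_abs_energyRate_le {δ : ℝ} (hδ : 0 < δ) (M : ℝ) :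
    ∃ C, ∀ a b J J' G G' : ℝ, |a| ≤ 1 → 0 ≤ b → |b| ≤ 1 → |J| ≤ M → |J'| ≤ M → |G| ≤ M →
      |G'| ≤ M → |energyRate δ a b J J' G G'| ≤ C := by
  have hK : IsCompact (Icc (-1 : ℝ) 1 ×ˢ Icc (0 : ℝ) 1 ×ˢ Icc (-M) M ×ˢ Icc (-M) M ×ˢ
      Icc (-M) M ×ˢ Icc (-M) M) :=
    isCompact_Icc.prod (isCompact_Icc.prod (isCompact_Icc.prod (isCompact_Icc.prod
      (isCompact_Icc.prod isCompact_Icc))))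
  obtain ⟨C, hC⟩ := hK.exists_bound_of_continuousOn
    ((continuousOn_energyRate hδ).mono fun z hz => hz.2.1.1)
  exact ⟨C, fun a b J J' G G' ha hb hb1 h1 h2 h3 h4 => hC (a, b, J, J', G, G')
    ⟨abs_le.1 ha, ⟨hb, (abs_le.1 hb1).2⟩, abs_le.1 h1, abs_le.1 h2, abs_le.1 h3, abs_le.1 h4⟩⟩

theorem integrable_stMeasure_of_slab {F : Torus3 × ℝ → ℝ} {a b C : ℝ}
    (hF : AEStronglyMeasurable F stMeasure) (hC : ∀ᵐ p ∂stMeasure, |F p| ≤ C)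
    (h0 : ∀ p, p.2 ∉ Icc a b → F p = 0) : Integrable F stMeasure := by
  have hK : IsCompact (univ ×ˢ Icc a b : Set (Torus3 × ℝ)) := isCompact_univ.prod isCompact_Icc
  have hfin : stMeasure (univ ×ˢ Icc a b : Set (Torus3 × ℝ)) < ⊤ := by
    rw [stMeasure_eq]
    exact (Measure.restrict_apply_le _ _).trans_lt hK.measure_lt_top
  have : IsFiniteMeasure (stMeasure.restrict (univ ×ˢ Icc a b : Set (Torus3 × ℝ))) :=
    ⟨by simpa using hfin⟩
  rw [← integrableOn_iff_integrable_of_support_subset (s := univ ×ˢ Icc a b)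
    fun p hp => ⟨mem_univ _, by_contra fun h => hp (h0 p h)⟩]
  exact Integrable.of_bound hF.restrict C (ae_restrict_of_ae hC)

theorem abs_sq_div_le {a b δ : ℝ} (hδ : 0 < δ) (ha : 0 ≤ a) (ha1 : a ≤ 1) (hb : 0 ≤ b)
    (hb1 : b ≤ 1) : |(a - b) ^ 2 / (b + δ)| ≤ 1 / δ := by
  rw [abs_of_nonneg (by positivity)]
  exact div_le_div₀ zero_le_one (by nlinarith) hδ (by linarith)

theorem tendsto_energyRate {δ : ℝ} {x₁ x₂ x₃ x₄ x₅ x₆ : ℕ → ℝ} {y₁ y₂ y₃ y₄ y₅ y₆ : ℝ}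
    (hy : y₂ + δ ≠ 0) (h₁ : Tendsto x₁ atTop (𝓝 y₁)) (h₂ : Tendsto x₂ atTop (𝓝 y₂))
    (h₃ : Tendsto x₃ atTop (𝓝 y₃)) (h₄ : Tendsto x₄ atTop (𝓝 y₄)) (h₅ : Tendsto x₅ atTop (𝓝 y₅))
    (h₆ : Tendsto x₆ atTop (𝓝 y₆)) :
    Tendsto (fun n => energyRate δ (x₁ n) (x₂ n) (x₃ n) (x₄ n) (x₅ n) (x₆ n)) atTop
      (𝓝 (energyRate δ y₁ y₂ y₃ y₄ y₅ y₆)) := by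
  have hγ := h₂.add_const δ
  exact (((((h₃.sub h₄).const_mul 2).mul (h₅.sub h₆)).div hγ hy).sub
    ((((h₁.sub h₂).const_mul 2).div (hγ.pow 2) (pow_ne_zero 2 hy)).mul
      (((h₃.sub h₄).mul h₆).add (h₄.mul (h₅.sub h₆))))).add
    (((((h₁.sub h₂).pow 2).const_mul 2).div (hγ.pow 3) (pow_ne_zero 3 hy)).mul (h₄.mul h₆))

theorem aemeasurable_energyRate {α : Type*} {_ : MeasurableSpace α} {μ : Measure α} {δ : ℝ}
    {f₁ f₂ f₃ f₄ f₅ f₆ : α → ℝ} (h₁ : AEMeasurable f₁ μ) (h₂ : AEMeasurable f₂ μ)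
    (h₃ : AEMeasurable f₃ μ) (h₄ : AEMeasurable f₄ μ) (h₅ : AEMeasurable f₅ μ)
    (h₆ : AEMeasurable f₆ μ) :
    AEMeasurable (fun x => energyRate δ (f₁ x) (f₂ x) (f₃ x) (f₄ x) (f₅ x) (f₆ x)) μ := by
  have hγ := h₂.add_const δ
  exact (((((h₃.sub h₄).const_mul 2).mul (h₅.sub h₆)).div hγ).sub
    ((((h₁.sub h₂).const_mul 2).div (hγ.pow_const 2)).mul
      (((h₃.sub h₄).mul h₆).add (h₄.mul (h₅.sub h₆))))).add
    (((((h₁.sub h₂).pow_const 2).const_mul 2).div (hγ.pow_const 3)).mul (h₄.mul h₆))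

/-- The energy identity for the weighted square distance of two bounded flows. -/
theorem integral_energy_eq_zero {M : ℝ} {c c' : Torus3 × ℝ → ℝ} {J J' g g' : Torus3 × ℝ → E3}
    (h : IsBoundedFlow M c J g) (h' : IsBoundedFlow M c' J' g') {δ : ℝ} (hδ : 0 < δ)
    {θ θ' : ℝ → ℝ} (hθ : ∀ t, HasDerivAt θ (θ' t) t) (hθ'c : Continuous θ') {a b : ℝ}
    (ha : 0 < a) (hθ0 : ∀ t ∉ Icc a b, θ t = 0) (hθ'0 : ∀ t ∉ Icc a b, θ' t = 0) :
    Integrable (fun p => θ' p.2 * ((c p - c' p) ^ 2 / (c' p + δ))) stMeasure ∧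
    Integrable (fun p => θ p.2 * ∑ k, energyRate δ (c p) (c' p) (J p k) (J' p k) (g p k) (g' p k))
      stMeasure ∧
    ∫ p, θ' p.2 * ((c p - c' p) ^ 2 / (c' p + δ)) ∂stMeasure +
      ∫ p, θ p.2 * ∑ k, energyRate δ (c p) (c' p) (J p k) (J' p k) (g p k) (g' p k) ∂stMeasure
      = 0 := by
  obtain ⟨C, hC⟩ := exists_abs_energyRate_le hδ M
  -- `IsBoundedFlow` does not require `0 ≤ M`; the sign is read off at any point where the flux
  -- bound holds.
  have hM0 : 0 ≤ M ∨ stMeasure = 0 := by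
    by_cases h0 : stMeasure = 0
    · exact Or.inr h0
    · have : NeBot (ae stMeasure) := ae_neBot.2 h0
      obtain ⟨p, hp⟩ := (h.flux_le 0).exists
      exact Or.inl ((abs_nonneg _).trans hp)
  have hb := h.bounds
  have hb' := h'.bounds
  have hJ := ae_all_iff.2 h.flux_le
  have hJ' := ae_all_iff.2 h'.flux_le
  have hg := ae_all_iff.2 h.grad_le
  have hg' := ae_all_iff.2 h'.grad_le
  have cθ : Continuous θ := continuous_iff_continuousAt.2 fun t => (hθ t).continuousAt
  obtain ⟨Cθ, hCθ⟩ := (HasCompactSupport.intro isCompact_Icc hθ0).exists_bound_of_continuous cθ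
  obtain ⟨Cθ', hCθ'⟩ := (HasCompactSupport.intro isCompact_Icc hθ'0).exists_bound_of_continuous hθ'c
  have hCθ0 : 0 ≤ Cθ := (norm_nonneg _).trans (hCθ 0)
  have hCθ'0 : 0 ≤ Cθ' := (norm_nonneg _).trans (hCθ' 0)
  have bound1 : ∀ (t x y : ℝ), 0 ≤ x → x ≤ 1 → 0 ≤ y → y ≤ 1 →
      |θ' t * ((x - y) ^ 2 / (y + δ))| ≤ Cθ' * (1 / δ) := fun t x y hx hx1 hy hy1 => by
    rw [abs_mul]
    exact mul_le_mul (hCθ' t) (abs_sq_div_le hδ hx hx1 hy hy1) (abs_nonneg _) hCθ'0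
  have bound2 : ∀ (t x y : ℝ) (j j' γ γ' : Fin 3 → ℝ), 0 ≤ x → x ≤ 1 → 0 ≤ y → y ≤ 1 →
      (∀ k, |j k| ≤ M) → (∀ k, |j' k| ≤ M) → (∀ k, |γ k| ≤ M) → (∀ k, |γ' k| ≤ M) →
      |θ t * ∑ k, energyRate δ x y (j k) (j' k) (γ k) (γ' k)| ≤ Cθ * (3 * C) := by
    intro t x y j j' γ γ' hx hx1 hy hy1 h1 h2 h3 h4
    rw [abs_mul]
    refine mul_le_mul (hCθ t) ((Finset.abs_sum_le_sum_abs _ _).trans ?_) (abs_nonneg _) hCθ0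
    refine (Finset.sum_le_sum fun k _ => hC _ _ _ _ _ _ (by rwa [abs_of_nonneg hx]) hy
      (by rwa [abs_of_nonneg hy]) (h1 k) (h2 k) (h3 k) (h4 k)).trans ?_
    simp
  have mc := h.measurable.aemeasurable
  have mc' := h'.measurable.aemeasurable
  have mJ := fun k => (h.measurable_flux k).aemeasurable
  have mJ' := fun k => (h'.measurable_flux k).aemeasurable
  have mg := fun k => (h.measurable_grad k).aemeasurable
  have mg' := fun k => (h'.measurable_grad k).aemeasurable
  have i1 : Integrable (fun p => θ' p.2 * ((c p - c' p) ^ 2 / (c' p + δ))) stMeasure := by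
    refine integrable_stMeasure_of_slab (a := a) (b := b) (C := Cθ' * (1 / δ)) ?_ ?_
      fun p hp => by simp [hθ'0 _ hp]
    · exact ((hθ'c.comp continuous_snd).aemeasurable.mul
        (((mc.sub mc').pow_const 2).div (mc'.add_const δ))).aestronglyMeasurable
    · filter_upwards [hb, hb'] with p hp hp'
      exact bound1 _ _ _ hp.1 hp.2 hp'.1 hp'.2
  have i2 : Integrable (fun p => θ p.2 *
      ∑ k, energyRate δ (c p) (c' p) (J p k) (J' p k) (g p k) (g' p k)) stMeasure := by
    refine integrable_stMeasure_of_slab (a := a) (b := b) (C := Cθ * (3 * C)) ?_ ?_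
      fun p hp => by simp [hθ0 _ hp]
    · refine ((cθ.comp continuous_snd).aemeasurable.mul
        (Finset.aemeasurable_fun_sum _ fun k _ => ?_)).aestronglyMeasurable
      exact aemeasurable_energyRate mc mc' (mJ k) (mJ' k) (mg k) (mg' k)
    · filter_upwards [hb, hb', hJ, hJ', hg, hg'] with p hp hp' h1 h2 h3 h4
      exact bound2 _ _ _ _ _ _ _ hp.1 hp.2 hp'.1 hp'.2 h1 h2 h3 h4
  refine ⟨i1, i2, ?_⟩
  rcases hM0 with hM0 | hz
  swap
  · simp [hz]
  rw [← integral_add i1 i2]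
  -- Together with the kernel radius `r = a / 2` used below, this gives `r < a` and `b + r < T`.
  set T := b + a with hT
  obtain ⟨ρ, ρx, ρt, hρ, hρs⟩ := exists_kernel_seq
  set f : Fin 3 × Fin 6 → Torus3 × ℝ → ℝ := fun z => trunc T ((![c, c', fun q => J q z.1,
    fun q => J' q z.1, fun q => g q z.1, fun q => g' q z.1] : Fin 6 → Torus3 × ℝ → ℝ) z.2) with hf
  have hfi : ∀ z, Integrable (f z) := by
    rintro ⟨k, m⟩
    fin_cases m
    · exact integrable_trunc h.measurable h.abs_le
    · exact integrable_trunc h'.measurable h'.abs_le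
    · exact integrable_trunc (h.measurable_flux k) (h.flux_le k)
    · exact integrable_trunc (h'.measurable_flux k) (h'.flux_le k)
    · exact integrable_trunc (h.measurable_grad k) (h.grad_le k)
    · exact integrable_trunc (h'.measurable_grad k) (h'.grad_le k)
  obtain ⟨ns, hns, hconv⟩ := exists_seq_tendsto_mollify hfi hρ hρs
  set m : ℕ → (Torus3 × ℝ → ℝ) → Torus3 × ℝ → ℝ := fun n f => mollify volume (trunc T f) (ρ (ns n))
    with hm
  set L : (Torus3 × ℝ → ℝ) → (Torus3 × ℝ → ℝ) → (Fin 3 → Torus3 × ℝ → ℝ) →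
      (Fin 3 → Torus3 × ℝ → ℝ) → (Fin 3 → Torus3 × ℝ → ℝ) → (Fin 3 → Torus3 × ℝ → ℝ) →
      Torus3 × ℝ → ℝ := fun A B JA JB GA GB p =>
    θ' p.2 * ((A p - B p) ^ 2 / (B p + δ)) +
      θ p.2 * ∑ k, energyRate δ (A p) (B p) (JA k p) (JB k p) (GA k p) (GB k p) with hL
  set Ln : ℕ → Torus3 × ℝ → ℝ := fun n => L (m n c) (m n c') (fun k => m n fun q => J q k)
    (fun k => m n fun q => J' q k) (fun k => m n fun q => g q k) (fun k => m n fun q => g' q k)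
    with hLn
  set L₀ : Torus3 × ℝ → ℝ := L (trunc T c) (trunc T c') (fun k => trunc T fun q => J q k)
    (fun k => trunc T fun q => J' q k) (fun k => trunc T fun q => g q k)
    (fun k => trunc T fun q => g' q k) with hL₀
  have hcm : ∀ n {f : Torus3 × ℝ → ℝ}, Integrable (trunc T f) → Continuous (m n f) := by
    intro n f hf
    obtain ⟨B, hB⟩ := (hρ (ns n)).bounded
    exact continuous_mollify hf (hρ (ns n)).continuous hB
  have tb : ∀ {f : Torus3 × ℝ → ℝ} {K : ℝ}, 0 ≤ K → (∀ᵐ p ∂stMeasure, |f p| ≤ K) → ∀ n p,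
      |m n f p| ≤ K := fun {f K} hK hf n p =>
    (hρ (ns n)).abs_mollify_le (ae_trunc (P := fun x => |x| ≤ K) (by simpa using hK) hf) p
  have tn : ∀ {f : Torus3 × ℝ → ℝ}, (∀ᵐ p ∂stMeasure, 0 ≤ f p) → ∀ n p, 0 ≤ m n f p :=
    fun {f} hf n p => mollify_nonneg (ae_trunc le_rfl hf) (hρ (ns n)).nonneg p
  have A0 := tn (hb.mono fun _ hp => hp.1)
  have B0 := tn (hb'.mono fun _ hp => hp.1)
  have A1 : ∀ n p, m n c p ≤ 1 := fun n p => (abs_le.1 (tb zero_le_one h.abs_le n p)).2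
  have B1 : ∀ n p, m n c' p ≤ 1 := fun n p => (abs_le.1 (tb zero_le_one h'.abs_le n p)).2
  have hlim : Tendsto (fun n => ∫ p, Ln n p) atTop (𝓝 (∫ p, L₀ p)) := by
    have hK : IsCompact (univ ×ˢ Icc a b : Set (Torus3 × ℝ)) := isCompact_univ.prod isCompact_Icc
    refine tendsto_integral_of_dominated_convergence ((univ ×ˢ Icc a b).indicator
      fun _ => Cθ' * (1 / δ) + Cθ * (3 * C)) (fun n => ?_) ?_ (fun n => ?_) ?_
    · have q1 := (hcm n (hfi (0, 0))).aemeasurable (μ := (volume : Measure (Torus3 × ℝ)))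
      have q2 := (hcm n (hfi (0, 1))).aemeasurable (μ := (volume : Measure (Torus3 × ℝ)))
      refine (((hθ'c.comp continuous_snd).aemeasurable.mul
        (((q1.sub q2).pow_const 2).div (q2.add_const δ))).add
        ((cθ.comp continuous_snd).aemeasurable.mul
        (Finset.aemeasurable_fun_sum _ fun k _ => ?_))).aestronglyMeasurable
      have q3 := (hcm n (hfi (k, 2))).aemeasurable (μ := (volume : Measure (Torus3 × ℝ)))
      have q4 := (hcm n (hfi (k, 3))).aemeasurable (μ := (volume : Measure (Torus3 × ℝ)))
      have q5 := (hcm n (hfi (k, 4))).aemeasurable (μ := (volume : Measure (Torus3 × ℝ)))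
      have q6 := (hcm n (hfi (k, 5))).aemeasurable (μ := (volume : Measure (Torus3 × ℝ)))
      exact aemeasurable_energyRate q1 q2 q3 q4 q5 q6
    · rw [integrable_indicator_iff hK.measurableSet]
      exact integrableOn_const hK.measure_lt_top.ne
    · refine Eventually.of_forall fun p => ?_
      by_cases hp : p.2 ∈ Icc a b
      · rw [indicator_of_mem (show p ∈ univ ×ˢ Icc a b from ⟨mem_univ _, hp⟩)]
        refine (abs_add_le _ _).trans (add_le_add (bound1 _ _ _ (A0 n p) (A1 n p) (B0 n p) (B1 n p))
          (bound2 _ _ _ _ _ _ _ (A0 n p) (A1 n p) (B0 n p) (B1 n p) ?_ ?_ ?_ ?_))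
        · exact fun k => tb hM0 (h.flux_le k) n p
        · exact fun k => tb hM0 (h'.flux_le k) n p
        · exact fun k => tb hM0 (h.grad_le k) n p
        · exact fun k => tb hM0 (h'.grad_le k) n p
      · rw [indicator_of_notMem (fun hq : p ∈ univ ×ˢ Icc a b => hp hq.2)]
        simp [hLn, hL, hθ0 _ hp, hθ'0 _ hp]
    · filter_upwards [hconv, ae_trunc (T := T) (P := fun x => 0 ≤ x) le_rfl
        (hb'.mono fun _ hp => hp.1)] with p hp hBp
      have l1 : Tendsto (fun n => m n c p) atTop (𝓝 (trunc T c p)) := hp (0, 0)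
      have l2 : Tendsto (fun n => m n c' p) atTop (𝓝 (trunc T c' p)) := hp (0, 1)
      have hγ : trunc T c' p + δ ≠ 0 := (add_pos_of_nonneg_of_pos hBp hδ).ne'
      refine ((((l1.sub l2).pow 2).div (l2.add_const δ) hγ).const_mul _).add
        ((tendsto_finsetSum _ fun k _ => ?_).const_mul _)
      have l3 : Tendsto (fun n => m n (fun q => J q k) p) atTop (𝓝 (trunc T (fun q => J q k) p)) :=
        hp (k, 2)
      have l4 : Tendsto (fun n => m n (fun q => J' q k) p) atTop
        (𝓝 (trunc T (fun q => J' q k) p)) := hp (k, 3)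
      have l5 : Tendsto (fun n => m n (fun q => g q k) p) atTop (𝓝 (trunc T (fun q => g q k) p)) :=
        hp (k, 4)
      have l6 : Tendsto (fun n => m n (fun q => g' q k) p) atTop
        (𝓝 (trunc T (fun q => g' q k) p)) := hp (k, 5)
      exact tendsto_energyRate hγ l1 l2 l3 l4 l5 l6
  have hzero : ∀ᶠ n in atTop, ∫ p, Ln n p = 0 := by
    have hU : {p : Torus3 × ℝ | |p.2| < a / 2} ∈ 𝓝 0 :=
      (isOpen_lt (by fun_prop) continuous_const).mem_nhds (by simpa using ha)
    filter_upwards [hns.tendsto_atTop.eventually (hρs _ hU)] with n hn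
    exact integral_mollified_energy h h' hδ hθ hθ'c (r := a / 2) (by linarith) (by linarith) hθ0 hθ'0
      (hρ (ns n)) fun p hp => (hn p hp).le
  have hL₀0 : ∫ p, L₀ p = 0 :=
    tendsto_nhds_unique hlim (tendsto_const_nhds.congr' (hzero.mono fun n hn => hn.symm))
  rw [integral_stMeasure_eq (T := T), ← hL₀0]
  · refine integral_congr_ae (Eventually.of_forall fun p => ?_)
    by_cases hp : p.2 ∈ Icc a b
    · have t1 : 0 < p.2 := ha.trans_le hp.1
      have t2 : p.2 ≤ T := by linarith [hp.2]
      simp only [hL₀, hL, trunc_of_mem t1 t2]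
    · have : L₀ p = 0 := by simp [hL₀, hL, hθ0 _ hp, hθ'0 _ hp]
      rw [this]
      by_cases hmem : p ∈ (univ ×ˢ Ioc 0 T : Set (Torus3 × ℝ))
      · rw [trunc, indicator_of_mem hmem]
        simp [hθ0 _ hp, hθ'0 _ hp]
      · exact indicator_of_notMem hmem _
  · intro q hq
    have hp : q.2 ∉ Icc a b := fun hp => by linarith [hp.2]
    simp [hθ0 _ hp, hθ'0 _ hp]

/-! ### Gronwall argument -/

/-- Squaring makes the positive part continuously differentiable, as a weight `θ` must be. -/
theorem hasDerivAt_posPart_sq (x : ℝ) : HasDerivAt (fun x : ℝ => max x 0 ^ 2) (2 * max x 0) x := by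
  rcases lt_trichotomy x 0 with hx | rfl | hx
  · rw [max_eq_right hx.le, mul_zero]
    refine (hasDerivAt_const x (0 : ℝ)).congr_of_eventuallyEq ?_
    filter_upwards [Iio_mem_nhds hx] with y hy
    simp [max_eq_right (mem_Iio.1 hy).le]
  · have h1 : (fun x : ℝ => max x 0 ^ 2) =O[𝓝 0] fun x => ‖x - 0‖ ^ 2 := by
      refine Asymptotics.IsBigO.of_bound 1 (Eventually.of_forall fun y => ?_)
      rw [sub_zero, norm_pow, norm_pow, norm_norm, one_mul]
      refine pow_le_pow_left₀ (norm_nonneg _) ?_ 2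
      rw [Real.norm_eq_abs, Real.norm_eq_abs, abs_of_nonneg (le_max_right _ _)]
      exact max_le (le_abs_self y) (abs_nonneg y)
    simpa using (h1.hasFDerivAt one_lt_two).hasDerivAt
  · rw [max_eq_left hx.le]
    have h1 : HasDerivAt (fun x : ℝ => x ^ 2) (2 * x) x := by simpa using hasDerivAt_pow 2 x
    refine h1.congr_of_eventuallyEq ?_
    filter_upwards [Ioi_mem_nhds hx] with y hy
    simp [max_eq_left (mem_Ioi.1 hy).le]

theorem deriv_smoothTransition_eq_zero {s : ℝ} (hs : s ∉ Icc (0 : ℝ) 1) :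
    deriv Real.smoothTransition s = 0 := by
  rw [mem_Icc, not_and_or, not_le, not_le] at hs
  rcases hs with hs | hs
  · have h : Real.smoothTransition =ᶠ[𝓝 s] fun _ => 0 := by
      filter_upwards [Iio_mem_nhds hs] with x hx
      exact Real.smoothTransition.zero_of_nonpos (le_of_lt hx)
    simp [h.deriv_eq]
  · have h : Real.smoothTransition =ᶠ[𝓝 s] fun _ => 1 := by
      filter_upwards [Ioi_mem_nhds hs] with x hx
      exact Real.smoothTransition.one_of_one_le (le_of_lt hx)
    simp [h.deriv_eq]

theorem continuous_deriv_smoothTransition : Continuous (deriv Real.smoothTransition) :=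
  (Real.smoothTransition.contDiff (n := 1)).continuous_deriv (by simp)

theorem exists_deriv_smoothTransition_le : ∃ L, ∀ s, |deriv Real.smoothTransition s| ≤ L :=
  (HasCompactSupport.intro isCompact_Icc fun _ hs =>
    deriv_smoothTransition_eq_zero hs).exists_bound_of_continuous continuous_deriv_smoothTransition

/-- The weak differential inequality `E' ≤ K E` for `E(t) = ∫ F(x,t) dx`, tested with functions
of time. -/
def SatisfiesGronwall (K : ℝ) (F : Torus3 × ℝ → ℝ) : Prop :=
  ∀ (θ θ' : ℝ → ℝ) (a b : ℝ), (∀ t, HasDerivAt θ (θ' t) t) → Continuous θ' → (∀ t, 0 ≤ θ t) →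
    0 < a → (∀ t ∉ Icc a b, θ t = 0) → (∀ t ∉ Icc a b, θ' t = 0) →
    0 ≤ ∫ p, (θ' p.2 + K * θ p.2) * F p ∂stMeasure

/-- The weighted integral of `F` after `t₀` is controlled by its values near time zero. -/
theorem integral_late_le {F : Torus3 × ℝ → ℝ} {B K L η τ t₀ T : ℝ}
    (hFm : AEStronglyMeasurable F stMeasure) (hF0 : ∀ᵐ p ∂stMeasure, 0 ≤ F p)
    (hFB : ∀ᵐ p ∂stMeasure, F p ≤ B) (hK : 0 ≤ K) (hG : SatisfiesGronwall K F)
    (hL : ∀ s, |deriv Real.smoothTransition s| ≤ L) (hτ : 0 < τ) (ht₀ : 0 < t₀)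
    (hT : 0 < T)
    (hinit : ∀ᵐ t : ℝ, 0 < t → t < τ → ∫ x : Torus3, F (x, t) ≤ η) :
    ∫ p, (if t₀ ≤ p.2 then 1 else 0) * (Real.exp (-K * p.2) * (2 * max (T - p.2) 0)) * F p
      ∂stMeasure ≤ 2 * L * T ^ 2 * η := by
  have hL0 : 0 ≤ L := (abs_nonneg _).trans (hL 0)
  -- The cutoff `χ` rises from 0 to 1 on `[b, 2b]`: before `τ`, so that `χ'` sees only small
  -- energies, and before `t₀`, so that `χ = 1` afterwards.
  obtain ⟨b, hb, hbτ, hbt⟩ : ∃ b : ℝ, 0 < b ∧ 2 * b ≤ τ ∧ 2 * b ≤ t₀ :=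
    ⟨min τ t₀ / 2, by positivity, by linarith [min_le_left τ t₀], by linarith [min_le_right τ t₀]⟩
  set χ : ℝ → ℝ := fun t => Real.smoothTransition (t / b - 1) with hχ
  set χ' : ℝ → ℝ := fun t => deriv Real.smoothTransition (t / b - 1) * b⁻¹ with hχ'
  set q : ℝ → ℝ := fun t => max (T - t) 0 ^ 2 with hq
  set q' : ℝ → ℝ := fun t => 2 * max (T - t) 0 with hq'
  set E : ℝ → ℝ := fun t => Real.exp (-K * t) with hE
  have dχ : ∀ t, HasDerivAt χ (χ' t) t := fun t => by
    have h1 : HasDerivAt (fun t : ℝ => t / b - 1) b⁻¹ t := by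
      simpa using ((hasDerivAt_id t).div_const b).sub_const 1
    have h2 := ((Real.smoothTransition.contDiff (n := 1)).differentiable (by simp)
      (t / b - 1)).hasDerivAt
    exact h2.comp t h1
  have dq : ∀ t, HasDerivAt q (-q' t) t := fun t => by
    have := (hasDerivAt_posPart_sq (T - t)).comp_const_sub T t
    exact this
  have dE : ∀ t, HasDerivAt E (-K * E t) t := fun t => by
    have h1 : HasDerivAt (fun t : ℝ => -K * t) (-K) t := by
      simpa using (hasDerivAt_id t).const_mul (-K)
    simpa [hE, mul_comm] using h1.exp
  have cχ' : Continuous χ' := by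
    have := continuous_deriv_smoothTransition
    fun_prop
  have cχ : Continuous χ := continuous_iff_continuousAt.2 fun t => (dχ t).continuousAt
  have cq : Continuous q := by fun_prop
  have cq' : Continuous q' := by fun_prop
  have cE : Continuous E := by fun_prop
  have E0 : ∀ t, 0 ≤ E t := fun t => (Real.exp_pos _).le
  have χ0 : ∀ t, 0 ≤ χ t := fun t => Real.smoothTransition.nonneg _
  have χ1 : ∀ t, χ t ≤ 1 := fun t => Real.smoothTransition.le_one _
  have q0 : ∀ t, 0 ≤ q t := fun t => sq_nonneg _
  have q'0 : ∀ t, 0 ≤ q' t := fun t => mul_nonneg two_pos.le (le_max_right _ _)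
  have χz : ∀ t, t < b → χ t = 0 := fun t ht => Real.smoothTransition.zero_of_nonpos (by
    have := (div_lt_one hb).2 ht
    linarith)
  have χ'z : ∀ t, t ∉ Icc b (2 * b) → χ' t = 0 := fun t ht => by
    have : deriv Real.smoothTransition (t / b - 1) = 0 :=
      deriv_smoothTransition_eq_zero fun h => ht ⟨by
        have := h.1
        rw [sub_nonneg, le_div_iff₀ hb] at this
        linarith, by
        have := h.2
        rw [sub_le_iff_le_add, div_le_iff₀ hb] at this
        linarith⟩
    simp [hχ', this]
  have qz : ∀ t, T < t → q t = 0 := fun t ht => by simp [hq, max_eq_right (by linarith : T - t ≤ 0)]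
  have q'z : ∀ t, T < t → q' t = 0 := fun t ht => by
    simp [hq', max_eq_right (by linarith : T - t ≤ 0)]
  -- The exponential is an integrating factor, so `θ' + Kθ = E (χ' q - χ q')`: a gain at late times
  -- is paid for by the initial layer.
  have hθ := hG (fun t => E t * (χ t * q t))
    (fun t => -K * E t * (χ t * q t) + E t * (χ' t * q t + χ t * -q' t)) b T
    (fun t => (dE t).fun_mul ((dχ t).fun_mul (dq t))) (by fun_prop)
    (fun t => mul_nonneg (E0 t) (mul_nonneg (χ0 t) (q0 t))) hb
    (fun t ht => by
      rw [mem_Icc, not_and_or, not_le, not_le] at ht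
      rcases ht with ht | ht
      · simp [χz t ht]
      · simp [qz t ht])
    (fun t ht => by
      rw [mem_Icc, not_and_or, not_le, not_le] at ht
      rcases ht with ht | ht
      · simp [χz t ht, χ'z t fun h => absurd h.1 (not_le.2 ht)]
      · simp [qz t ht, q'z t ht])
  have hFabs : ∀ᵐ p ∂stMeasure, |F p| ≤ B := by
    filter_upwards [hF0, hFB] with p h1 h2
    rwa [abs_of_nonneg h1]
  have hpos : ∀ᵐ p ∂stMeasure, 0 < p.2 := by
    rw [stMeasure_eq, ae_restrict_iff' measurableSet_timeIoi]
    exact Eventually.of_forall fun p hp => hp.2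
  have hint : ∀ {w : ℝ → ℝ} {C a' b' : ℝ}, Measurable w → (∀ t, 0 < t → |w t| ≤ C) →
      (∀ t, t ∉ Icc a' b' → w t = 0) → Integrable (fun p => w p.2 * F p) stMeasure := by
    intro w C a' b' hw hwC hw0
    refine integrable_stMeasure_of_slab (a := a') (b := b') (C := C * B)
      ((hw.comp measurable_snd).aestronglyMeasurable.mul hFm) ?_ fun p hp => by simp [hw0 _ hp]
    filter_upwards [hFabs, hpos] with p hp hp0
    rw [abs_mul]
    exact mul_le_mul (hwC _ hp0) hp (abs_nonneg _) ((abs_nonneg _).trans (hwC _ hp0))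
  have E1 : ∀ t, 0 < t → E t ≤ 1 := fun t ht => by
    rw [hE, Real.exp_le_one_iff]
    nlinarith
  have qT : ∀ t, 0 < t → q t ≤ T ^ 2 := fun t ht =>
    pow_le_pow_left₀ (le_max_right _ _) (max_le (by linarith) hT.le) 2
  have q'T : ∀ t, 0 < t → q' t ≤ 2 * T := fun t ht =>
    mul_le_mul_of_nonneg_left (max_le (by linarith) hT.le) two_pos.le
  have χ'L : ∀ t, |χ' t| ≤ L * b⁻¹ := fun t => by
    rw [abs_mul, abs_of_pos (inv_pos.2 hb)]
    exact mul_le_mul_of_nonneg_right (hL _) (inv_pos.2 hb).le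
  have b1 : ∀ t, 0 < t → |E t * (χ' t * q t)| ≤ L * b⁻¹ * T ^ 2 := fun t ht => by
    rw [abs_mul, abs_mul, abs_of_nonneg (E0 t), abs_of_nonneg (q0 t)]
    have h1 := mul_le_mul (χ'L t) (qT t ht) (q0 t) (by positivity)
    have h2 : 0 ≤ |χ' t| * q t := mul_nonneg (abs_nonneg _) (q0 t)
    nlinarith [E1 t ht]
  have b2 : ∀ t, 0 < t → |E t * (χ t * q' t)| ≤ 2 * T := fun t ht => by
    rw [abs_of_nonneg (mul_nonneg (E0 t) (mul_nonneg (χ0 t) (q'0 t)))]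
    have h1 : χ t * q' t ≤ 2 * T := by nlinarith [χ1 t, q'T t ht, q'0 t]
    have h2 : 0 ≤ χ t * q' t := mul_nonneg (χ0 t) (q'0 t)
    nlinarith [E1 t ht]
  have i1 := hint (w := fun t => E t * (χ' t * q t)) (by fun_prop) b1 (a' := b) (b' := 2 * b)
    fun t ht => by simp [χ'z t ht]
  have i2 := hint (w := fun t => E t * (χ t * q' t)) (by fun_prop) b2 (a' := b) (b' := T)
    fun t ht => by
      rw [mem_Icc, not_and_or, not_le, not_le] at ht
      rcases ht with ht | ht
      · simp [χz t ht]
      · simp [q'z t ht]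
  set ind : ℝ → ℝ := (Ioc 0 (2 * b)).indicator 1 with hind
  have mind : Measurable ind := measurable_one.indicator measurableSet_Ioc
  have ind1 : ∀ t, |ind t| ≤ 1 := fun t => by
    by_cases ht : t ∈ Ioc 0 (2 * b) <;> simp [hind, ht]
  have i3 := hint (w := ind) mind (fun t _ => ind1 t) (a' := 0) (b' := 2 * b) fun t ht =>
    indicator_of_notMem (fun h => ht ⟨h.1.le, h.2⟩) _
  have hsplit : ∫ p, E p.2 * (χ p.2 * q' p.2) * F p ∂stMeasure ≤
      ∫ p, E p.2 * (χ' p.2 * q p.2) * F p ∂stMeasure := by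
    rw [← sub_nonneg, ← integral_sub i1 i2]
    convert hθ using 3 with p
    ring
  have hearly : ∫ p, E p.2 * (χ' p.2 * q p.2) * F p ∂stMeasure ≤
      L * b⁻¹ * T ^ 2 * ∫ p, ind p.2 * F p ∂stMeasure := by
    rw [← integral_const_mul]
    refine integral_mono_ae i1 (i3.const_mul _) ?_
    filter_upwards [hF0, hpos] with p hp hp0
    have h1 := (le_abs_self _).trans (b1 p.2 hp0)
    by_cases ht : p.2 ∈ Icc b (2 * b)
    · have : ind p.2 = 1 := indicator_of_mem (show p.2 ∈ Ioc 0 (2 * b) from ⟨hp0, ht.2⟩) 1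
      simp only [this, one_mul]
      exact mul_le_mul_of_nonneg_right h1 hp
    · simp only [χ'z _ ht, zero_mul, mul_zero]
      have : 0 ≤ ind p.2 := indicator_nonneg (fun _ _ => zero_le_one) _
      positivity
  -- The layer has length `2b`, which cancels the `1 / b` in the bound of `χ'`; the final estimate
  -- is therefore independent of `b`.
  have hind2 : ∫ p, ind p.2 * F p ∂stMeasure ≤ 2 * b * η := by
    rw [stMeasure, integral_prod_symm _ i3]
    have h1 : ∀ t : ℝ, ∫ x : Torus3, ind t * F (x, t) = ind t * ∫ x : Torus3, F (x, t) :=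
      fun t => integral_const_mul _ _
    simp only [h1]
    have h2 : ∫ t in Ioi (0 : ℝ), ind t * η = 2 * b * η := by
      rw [integral_mul_const, hind, integral_indicator measurableSet_Ioc,
        Measure.restrict_restrict measurableSet_Ioc,
        inter_eq_self_of_subset_left fun t ht => ht.1]
      simp [hb.le]
    rw [← h2]
    refine integral_mono_ae ?_ ?_ ?_
    · have := i3.integral_prod_right
      simpa only [h1] using this
    · refine Integrable.mul_const ?_ _
      rw [hind, integrable_indicator_iff measurableSet_Ioc]
      refine integrableOn_const ?_
      rw [Measure.restrict_apply measurableSet_Ioc]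
      exact ((measure_mono inter_subset_left).trans_lt measure_Ioc_lt_top).ne
    · refine (ae_restrict_iff' measurableSet_Ioi).2 ?_
      -- The endpoint may equal `τ`, where the strict inequality in `hinit` fails.
      have hne : ∀ᵐ t : ℝ, t ≠ 2 * b := by
        simp [ae_iff]
      filter_upwards [hinit, hne] with t ht hne ht0
      by_cases hm : t ∈ Ioc 0 (2 * b)
      · have : ind t = 1 := indicator_of_mem hm 1
        simp only [this, one_mul]
        exact ht ht0 ((hm.2.lt_of_ne hne).trans_le hbτ)
      · have : ind t = 0 := indicator_of_notMem hm 1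
        simp [this]
  calc _ ≤ ∫ p, E p.2 * (χ p.2 * q' p.2) * F p ∂stMeasure := by
        refine integral_mono_of_nonneg ?_ i2 ?_
        · filter_upwards [hF0] with p hp
          refine mul_nonneg (mul_nonneg ?_ (mul_nonneg (E0 _) (q'0 _))) hp
          split_ifs <;> norm_num
        · filter_upwards [hF0] with p hp
          refine mul_le_mul_of_nonneg_right ?_ hp
          split_ifs with h
          · have : χ p.2 = 1 := Real.smoothTransition.one_of_one_le (by
              have : 2 ≤ p.2 / b := by
                rw [le_div_iff₀ hb]
                linarith
              linarith)
            rw [this, one_mul, one_mul]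
          · rw [zero_mul]
            exact mul_nonneg (E0 _) (mul_nonneg (χ0 _) (q'0 _))
    _ ≤ L * b⁻¹ * T ^ 2 * (2 * b * η) := hsplit.trans (hearly.trans
        (mul_le_mul_of_nonneg_left hind2 (by positivity)))
    _ = 2 * L * T ^ 2 * η := by field_simp

/-- The bound of `integral_late_le` is proportional to `η`, and its left side does not depend on
`η`; letting `η → 0` makes `F` vanish where the weight is positive, that is for `t₀ ≤ t < T`. -/
theorem ae_eq_zero_of_gronwall {F : Torus3 × ℝ → ℝ} {B K : ℝ}
    (hFm : AEStronglyMeasurable F stMeasure) (hF0 : ∀ᵐ p ∂stMeasure, 0 ≤ F p)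
    (hFB : ∀ᵐ p ∂stMeasure, F p ≤ B) (hK : 0 ≤ K) (hG : SatisfiesGronwall K F)
    (hinit : ∀ η > 0, ∃ τ > 0, ∀ᵐ t : ℝ, 0 < t → t < τ → ∫ x : Torus3, F (x, t) ≤ η) :
    F =ᵐ[stMeasure] 0 := by
  obtain ⟨L, hL⟩ := exists_deriv_smoothTransition_le
  have hL0 : 0 ≤ L := (abs_nonneg _).trans (hL 0)
  have hpos : ∀ᵐ p ∂stMeasure, 0 < p.2 := by
    rw [stMeasure_eq, ae_restrict_iff' measurableSet_timeIoi]
    exact Eventually.of_forall fun p hp => hp.2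
  have key : ∀ t₀ T : ℝ, 0 < t₀ → 0 < T → ∀ᵐ p ∂stMeasure, t₀ ≤ p.2 → p.2 < T → F p = 0 := by
    intro t₀ T ht₀ hT
    set w : Torus3 × ℝ → ℝ := fun p => (if t₀ ≤ p.2 then 1 else 0) *
      (Real.exp (-K * p.2) * (2 * max (T - p.2) 0)) with hw
    have hw0 : ∀ p, 0 ≤ w p := fun p => by
      refine mul_nonneg (by split_ifs <;> norm_num) (mul_nonneg (Real.exp_pos _).le
        (mul_nonneg two_pos.le (le_max_right _ _)))
    have hwm : Measurable w := by
      refine Measurable.mul (Measurable.ite ?_ measurable_const measurable_const) (by fun_prop)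
      exact measurableSet_le measurable_const measurable_snd
    have hwi : Integrable (fun p => w p * F p) stMeasure := by
      refine integrable_stMeasure_of_slab (a := t₀) (b := T) (C := 2 * T * B)
        (hwm.aestronglyMeasurable.mul hFm) ?_ fun p hp => ?_
      · filter_upwards [hF0, hFB, hpos] with p h1 h2 h3
        rw [abs_of_nonneg (mul_nonneg (hw0 p) h1)]
        refine mul_le_mul ?_ h2 h1 (by positivity)
        have e1 : Real.exp (-K * p.2) ≤ 1 := by
          rw [Real.exp_le_one_iff]
          nlinarith
        have e2 : 2 * max (T - p.2) 0 ≤ 2 * T :=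
          mul_le_mul_of_nonneg_left (max_le (by linarith) hT.le) two_pos.le
        have e3 : 0 ≤ 2 * max (T - p.2) 0 := mul_nonneg two_pos.le (le_max_right _ _)
        have e4 : Real.exp (-K * p.2) * (2 * max (T - p.2) 0) ≤ 2 * T := by nlinarith
        simp only [hw]
        split_ifs
        · rwa [one_mul]
        · rw [zero_mul]
          positivity
      · rw [mem_Icc, not_and_or, not_le, not_le] at hp
        rcases hp with hp | hp
        · simp [hw, not_le.2 hp]
        · simp [hw, max_eq_right (by linarith : T - p.2 ≤ 0)]
    have hle : ∫ p, w p * F p ∂stMeasure ≤ 0 := by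
      refine le_of_forall_pos_le_add fun ε hε => ?_
      -- The `+ 1` avoids division by zero, since only `0 ≤ L` is known.
      have hη : 0 < ε / (2 * L * T ^ 2 + 1) := by positivity
      obtain ⟨τ, hτ, hτi⟩ := hinit _ hη
      refine (integral_late_le hFm hF0 hFB hK hG hL hτ ht₀ hT hτi).trans ?_
      rw [zero_add, ← mul_div_assoc, div_le_iff₀ (by positivity)]
      nlinarith
    have hnn : 0 ≤ᵐ[stMeasure] fun p => w p * F p := hF0.mono fun p hp => mul_nonneg (hw0 p) hp
    have h0 := (integral_eq_zero_iff_of_nonneg_ae hnn hwi).1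
      (le_antisymm hle (integral_nonneg_of_ae hnn))
    filter_upwards [h0] with p hp h1 h2
    have hwp : w p ≠ 0 := by
      have : 0 < max (T - p.2) 0 := lt_max_of_lt_left (by linarith)
      simp only [hw, if_pos h1, one_mul]
      positivity
    exact (mul_eq_zero.1 hp).resolve_left hwp
  -- Countably many windows `[1/(m+1), m+1)` exhaust the positive times.
  have hall := ae_all_iff.2 fun m : ℕ => key (1 / ((m : ℝ) + 1)) (m + 1) (by positivity)
    (by positivity)
  filter_upwards [hall, hpos] with p hp hp0
  obtain ⟨m₁, hm₁⟩ := exists_nat_one_div_lt hp0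
  obtain ⟨m₂, hm₂⟩ := exists_nat_gt p.2
  have hmax₁ : (m₁ : ℝ) ≤ (max m₁ m₂ : ℕ) := by exact_mod_cast le_max_left _ _
  have hmax₂ : (m₂ : ℝ) ≤ (max m₁ m₂ : ℕ) := by exact_mod_cast le_max_right _ _
  refine hp (max m₁ m₂) (le_trans ?_ hm₁.le) (by linarith)
  exact one_div_le_one_div_of_le (by positivity) (by linarith)

/-! ### Renormalized solutions with bounded fluxes -/

/-- The friction coefficients `1 / Dᵢⱼ`, completed by `1` on the diagonal. -/
def friction {n : ℕ} (D : Fin n → Fin n → ℝ) (i j : Fin n) : ℝ := if i = j then 1 else 1 / D i j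

theorem force_apply {n : ℕ} (D : Fin n → Fin n → ℝ) (c : Fin n → Torus3 × ℝ → ℝ)
    (u : Fin n → Torus3 × ℝ → E3) (i : Fin n) (p : Torus3 × ℝ) (k : Fin 3) :
    force D c u i p k =
      -msOp (friction D) (fun j => c j p) (fun j => flux c u j p k) i := by
  -- The diagonal term of `msOp` is zero, so `friction` may take any positive value there.
  rw [force, msOp, ← Finset.sum_erase (a := i) Finset.univ (by simp)]
  simp only [PiLp.neg_apply, WithLp.ofLp_sum, Finset.sum_apply, PiLp.smul_apply, PiLp.sub_apply,
    smul_eq_mul]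
  congr 1
  refine Finset.sum_congr rfl fun j hj => ?_
  rw [friction, if_neg (Finset.ne_of_mem_erase hj).symm]

theorem halfDeriv_id {x : ℝ} (hx : 0 ≤ x) : halfDeriv (fun x => x) x = 1 :=
  derivWithin_id' x _ (uniqueDiffOn_Ici 0 x hx)

theorem halfDeriv_halfDeriv_id {x : ℝ} (hx : 0 ≤ x) : halfDeriv (halfDeriv fun x => x) x = 0 := by
  have h : derivWithin (halfDeriv fun x => x) (Ici 0) x = derivWithin (fun _ => (1 : ℝ)) (Ici 0) x :=
    derivWithin_congr (fun y hy => halfDeriv_id hy) (halfDeriv_id hx)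
  rw [halfDeriv, h]
  simp

section Solution

variable {n : ℕ} {D : Fin n → Fin n → ℝ} {c₀ : Fin n → Torus3 → ℝ} {c : Fin n → Torus3 × ℝ → ℝ}
  {u : Fin n → Torus3 × ℝ → E3}

theorem IsRenormalizedSolution.continuity (hc : IsRenormalizedSolution D c₀ c u) (i : Fin n)
    {φ : Torus3 × ℝ → ℝ} (hφ : IsTest φ) (hs : tsupport φ ⊆ univ ×ˢ Ioi (0 : ℝ)) :
    ∫ p, c i p * timeDeriv φ p ∂stMeasure +
      ∫ p, inner ℝ (flux c u i p) (spaceGrad φ p) ∂stMeasure = 0 := by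
  obtain ⟨g, -, -, h⟩ := hc.renormalized i
  -- With `β = id` the source term has `β'' = 0` and the flux term becomes `c u · ∇φ`; the initial
  -- term drops out because `φ` vanishes at `t = 0`.
  have h1 := (h φ hφ (fun x => x) contDiffOn_id).identity
  have h2 : ∫ x : Torus3, c₀ i x * φ (x, 0) = 0 := by
    have : ∀ x : Torus3, φ (x, 0) = 0 := fun x =>
      image_eq_zero_of_notMem_tsupport fun hx => lt_irrefl (0 : ℝ) (hs hx).2
    simp [this]
  have h3 : ∫ p, c i p * halfDeriv (halfDeriv fun x => x) (c i p) *
      inner ℝ (g p) (√(c i p) • u i p) * φ p ∂stMeasure = 0 := by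
    refine integral_eq_zero_of_ae ?_
    filter_upwards [hc.bounds i] with p hp
    simp [halfDeriv_halfDeriv_id hp.1]
  have h4 : ∫ p, √(c i p) * halfDeriv (fun x => x) (c i p) *
      inner ℝ (√(c i p) • u i p) (spaceGrad φ p) ∂stMeasure =
      ∫ p, inner ℝ (flux c u i p) (spaceGrad φ p) ∂stMeasure := by
    refine integral_congr_ae ?_
    filter_upwards [hc.bounds i] with p hp
    rw [halfDeriv_id hp.1, mul_one, flux, ← real_inner_smul_left, smul_smul,
      Real.mul_self_sqrt hp.1]
  rw [h2, h3, h4] at h1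
  linarith

theorem exists_flux_bound (h : ∀ i, MemLp (flux c u i) ⊤ stMeasure) :
    ∃ M, 0 ≤ M ∧ ∀ i k, ∀ᵐ p ∂stMeasure, |flux c u i p k| ≤ M := by
  refine ⟨∑ i, (eLpNorm (flux c u i) ⊤ stMeasure).toReal,
    Finset.sum_nonneg fun i _ => ENNReal.toReal_nonneg, fun i k => ?_⟩
  have hae : ∀ᵐ p ∂stMeasure, ‖flux c u i p‖ₑ ≤ eLpNorm (flux c u i) ⊤ stMeasure := by
    rw [eLpNorm_exponent_top]
    exact enorm_ae_le_eLpNormEssSup _ _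
  filter_upwards [hae] with p hp
  have h1 : ‖flux c u i p‖ ≤ (eLpNorm (flux c u i) ⊤ stMeasure).toReal := by
    have := ENNReal.toReal_mono (h i).2.ne hp
    rwa [toReal_enorm] at this
  refine ((PiLp.norm_apply_le (flux c u i p) k).trans h1).trans ?_
  exact Finset.single_le_sum (f := fun i => (eLpNorm (flux c u i) ⊤ stMeasure).toReal)
    (fun i _ => ENNReal.toReal_nonneg) (Finset.mem_univ i)

/-- The weak gradient of `cᵢ` is the force, which is bilinear in concentrations and fluxes and
therefore bounded when both are. -/
theorem IsRenormalizedSolution.isBoundedFlow (hc : IsRenormalizedSolution D c₀ c u) {Λ M : ℝ}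
    (hκ0 : ∀ i j, 0 ≤ friction D i j) (hκΛ : ∀ i j, friction D i j ≤ Λ)
    (hm : ∀ i, AEStronglyMeasurable (flux c u i) stMeasure)
    (hM : ∀ i k, ∀ᵐ p ∂stMeasure, |flux c u i p k| ≤ M) {M' : ℝ} (hMM' : M ≤ M')
    (hM' : 2 * n * Λ * (1 * M) ≤ M') (i : Fin n) :
    IsBoundedFlow M' (c i) (flux c u i) (force D c u i) := by
  have hmk : ∀ j k, AEMeasurable (fun p => flux c u j p k) stMeasure := fun j k =>
    ((PiLp.continuous_apply 2 (fun _ : Fin 3 => ℝ) k).comp_aestronglyMeasurable (hm j)).aemeasurable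
  refine ⟨hc.measurable i, fun k => (hmk i k).aestronglyMeasurable, fun k => ?_, hc.bounds i,
    fun k => (hM i k).mono fun p hp => hp.trans hMM', fun k => ?_, hc.force_flux i,
    fun φ hφ hs => hc.continuity i hφ hs⟩
  · simp only [force_apply, msOp]
    refine (Finset.aemeasurable_fun_sum _ fun j _ => ?_).neg.aestronglyMeasurable
    exact (((hc.measurable j).aemeasurable.mul (hmk i k)).sub
      ((hc.measurable i).aemeasurable.mul (hmk j k))).const_mul _
  · filter_upwards [ae_all_iff.2 hc.bounds, ae_all_iff.2 fun j => hM j k] with p hp hJ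
    rw [force_apply, abs_neg]
    refine (abs_sum_kernel_le hκ0 hκΛ (A := 1) (fun j => ?_) hJ i).trans hM'
    rw [abs_of_nonneg (hp j).1]
    exact (hp j).2

theorem IsRenormalizedSolution.slice (hc : IsRenormalizedSolution D c₀ c u) (i : Fin n) :
    ∀ᵐ t : ℝ, 0 < t → AEStronglyMeasurable (fun x : Torus3 => c i (x, t)) volume ∧
      ∀ᵐ x : Torus3, 0 ≤ c i (x, t) ∧ c i (x, t) ≤ 1 := by
  refine (ae_restrict_iff' (s := Ioi (0 : ℝ)) measurableSet_Ioi).1 ?_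
  have h1 := (hc.measurable i).prodMk_right
  have h2 : ∀ᵐ z ∂((volume : Measure ℝ).restrict (Ioi 0)).prod (volume : Measure Torus3),
      0 ≤ c i z.swap ∧ c i z.swap ≤ 1 :=
    Measure.measurePreserving_swap.quasiMeasurePreserving.ae (hc.bounds i)
  filter_upwards [h1, Measure.ae_ae_of_ae_prod h2] with t ht1 ht2
  exact ⟨ht1, ht2⟩

theorem IsRenormalizedSolution.initial_close (hc : IsRenormalizedSolution D c₀ c u) (i : Fin n)
    {η : ℝ} (hη : 0 < η) : ∃ τ > 0, ∀ᵐ t : ℝ, 0 < t → t < τ →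
      ∫ x : Torus3, |c i (x, t) - c₀ i x| ≤ η := by
  have h1 := (hc.initial_trace i (fun x => x) continuousOn_id).eventually_le_const hη
  obtain ⟨s, hs, v, hv, hsv⟩ := Filter.mem_inf_iff_superset.1 h1
  obtain ⟨τ, hτ, hτs⟩ := mem_nhdsGT_iff_exists_Ioo_subset.1 hs
  refine ⟨τ, hτ, ?_⟩
  filter_upwards [hv] with t ht h0 hlt
  exact hsv ⟨hτs ⟨h0, hlt⟩, ht⟩

end Solution

theorem sq_div_le_abs {a b δ : ℝ} (hδ : 0 < δ) (ha : 0 ≤ a) (ha1 : a ≤ 1) (hb : 0 ≤ b)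
    (hb1 : b ≤ 1) : (a - b) ^ 2 / (b + δ) ≤ 1 / δ * |a - b| := by
  rw [one_div, inv_mul_eq_div]
  refine div_le_div₀ (abs_nonneg _) ?_ hδ (by linarith)
  rw [← sq_abs]
  have : |a - b| ≤ 1 := abs_le.2 ⟨by linarith, by linarith⟩
  nlinarith [abs_nonneg (a - b)]

/-- Both solutions are close in `L¹` to the same `c₀` at small times, and `(a - b)² / (b + δ) ≤ |a -
b| / δ` because `|a - b| ≤ 1`. -/
theorem energy_initial_small {n : ℕ} {D : Fin n → Fin n → ℝ} {c₀ : Fin n → Torus3 → ℝ}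
    (hc₀ : IsInitialData c₀) {c c' : Fin n → Torus3 × ℝ → ℝ} {u u' : Fin n → Torus3 × ℝ → E3}
    (hc : IsRenormalizedSolution D c₀ c u) (hc' : IsRenormalizedSolution D c₀ c' u') {δ : ℝ}
    (hδ : 0 < δ) {η : ℝ} (hη : 0 < η) : ∃ τ > 0, ∀ᵐ t : ℝ, 0 < t → t < τ →
      ∫ x : Torus3, ∑ i, (c i (x, t) - c' i (x, t)) ^ 2 / (c' i (x, t) + δ) ≤ η := by
  -- Two errors for each of `n` species, divided by `δ`, add up to `n η / (n + 1) ≤ η`.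
  set ε : ℝ := δ * η / (2 * (n + 1)) with hε
  have hε0 : 0 < ε := by positivity
  choose τ hτ h using fun i => hc.initial_close i hε0
  choose τ' hτ' h' using fun i => hc'.initial_close i hε0
  obtain ⟨σ, hσ, hσle⟩ : ∃ σ > 0, ∀ i, σ ≤ τ i ∧ σ ≤ τ' i := by
    rcases isEmpty_or_nonempty (Fin n) with hn | hn
    · exact ⟨1, one_pos, fun i => isEmptyElim i⟩
    · obtain ⟨i₀, hi₀⟩ := Finite.exists_min fun i => min (τ i) (τ' i)
      exact ⟨_, lt_min (hτ i₀) (hτ' i₀), fun i => le_min_iff.1 (hi₀ i)⟩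
  refine ⟨σ, hσ, ?_⟩
  filter_upwards [ae_all_iff.2 h, ae_all_iff.2 h', ae_all_iff.2 hc.slice,
    ae_all_iff.2 hc'.slice] with t h1 h2 h3 h4 ht0 htσ
  have i0 : ∀ i, Integrable (c₀ i) volume := fun i => (hc₀.bounded i).integrable le_top
  have i1 : ∀ i, Integrable (fun x : Torus3 => c i (x, t)) volume := fun i =>
    Integrable.of_bound (h3 i ht0).1 1 ((h3 i ht0).2.mono fun x hx => by
      rw [Real.norm_eq_abs, abs_of_nonneg hx.1]; exact hx.2)
  have i2 : ∀ i, Integrable (fun x : Torus3 => c' i (x, t)) volume := fun i =>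
    Integrable.of_bound (h4 i ht0).1 1 ((h4 i ht0).2.mono fun x hx => by
      rw [Real.norm_eq_abs, abs_of_nonneg hx.1]; exact hx.2)
  have j1 : ∀ i, Integrable (fun x : Torus3 => |c i (x, t) - c₀ i x|) volume := fun i =>
    ((i1 i).sub (i0 i)).abs
  have j2 : ∀ i, Integrable (fun x : Torus3 => |c' i (x, t) - c₀ i x|) volume := fun i =>
    ((i2 i).sub (i0 i)).abs
  have hbd : ∀ᵐ x : Torus3, ∀ i, (0 ≤ c i (x, t) ∧ c i (x, t) ≤ 1) ∧
      (0 ≤ c' i (x, t) ∧ c' i (x, t) ≤ 1) := ae_all_iff.2 fun i => (h3 i ht0).2.and (h4 i ht0).2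
  have j3 : ∀ i, Integrable (fun x : Torus3 =>
      1 / δ * (|c i (x, t) - c₀ i x| + |c' i (x, t) - c₀ i x|)) volume := fun i =>
    ((j1 i).add (j2 i)).const_mul _
  calc ∫ x : Torus3, ∑ i, (c i (x, t) - c' i (x, t)) ^ 2 / (c' i (x, t) + δ)
      ≤ ∫ x : Torus3, ∑ i, 1 / δ * (|c i (x, t) - c₀ i x| + |c' i (x, t) - c₀ i x|) := by
        refine integral_mono_of_nonneg ?_ (integrable_finsetSum _ fun i _ => j3 i) ?_
        · filter_upwards [hbd] with x hx
          refine Finset.sum_nonneg fun i _ => ?_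
          have := (hx i).2.1
          positivity
        · filter_upwards [hbd] with x hx
          refine Finset.sum_le_sum fun i _ => ?_
          refine (sq_div_le_abs hδ (hx i).1.1 (hx i).1.2 (hx i).2.1 (hx i).2.2).trans ?_
          refine mul_le_mul_of_nonneg_left ?_ (by positivity)
          rw [abs_sub_comm (c' i (x, t))]
          exact abs_sub_le _ _ _
    _ = ∑ i, 1 / δ * ((∫ x : Torus3, |c i (x, t) - c₀ i x|) +
          (∫ x : Torus3, |c' i (x, t) - c₀ i x|)) := by
        rw [integral_finsetSum _ fun i _ => j3 i]
        refine Finset.sum_congr rfl fun i _ => ?_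
        rw [integral_const_mul, integral_add (j1 i) (j2 i)]
    _ ≤ ∑ _i : Fin n, 1 / δ * (ε + ε) := by
        refine Finset.sum_le_sum fun i _ => ?_
        have e1 := h1 i ht0 (htσ.trans_le (hσle i).1)
        have e2 := h2 i ht0 (htσ.trans_le (hσle i).2)
        gcongr
    _ = n / (n + 1) * η := by
        rw [Finset.sum_const, Finset.card_univ, Fintype.card_fin, nsmul_eq_mul, hε]
        field_simp
        ring
    _ ≤ η := by
        refine mul_le_of_le_one_left hη.le ?_
        rw [div_le_one (by positivity)]
        linarith

end MaxwellStefan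

end

/-! ### The uniqueness theorem -/

theorem theorem2p5 (n : ℕ) (D : Fin n → Fin n → ℝ)
    (hDsymm : ∀ i j : Fin n, i ≠ j → D i j = D j i)
    (hDpos : ∀ i j : Fin n, i ≠ j → 0 < D i j)
    (c₀ : Fin n → MaxwellStefan.Torus3 → ℝ)
    (hc₀ : MaxwellStefan.IsInitialData c₀)
    (c cbar : Fin n → MaxwellStefan.Torus3 × ℝ → ℝ)
    (u ubar : Fin n → MaxwellStefan.Torus3 × ℝ → MaxwellStefan.E3)
    (hc : MaxwellStefan.IsRenormalizedSolution D c₀ c u)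
    (hcbar : MaxwellStefan.IsRenormalizedSolution D c₀ cbar ubar)
    (hflux : ∀ i, MemLp (MaxwellStefan.flux c u i) ⊤ MaxwellStefan.stMeasure)
    (hfluxbar : ∀ i, MemLp (MaxwellStefan.flux cbar ubar i) ⊤ MaxwellStefan.stMeasure) :
    ∀ i, c i =ᵐ[MaxwellStefan.stMeasure] cbar i := by
  intro i₀
  have : Nonempty (Fin n) := ⟨i₀⟩
  have hfpos : ∀ i j, 0 < MaxwellStefan.friction D i j := fun i j => by
    rw [MaxwellStefan.friction]
    split_ifs with h
    · exact one_pos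
    · exact one_div_pos.2 (hDpos i j h)
  have hfsymm : ∀ i j, MaxwellStefan.friction D i j = MaxwellStefan.friction D j i := fun i j => by
    rcases eq_or_ne i j with rfl | h
    · rfl
    · rw [MaxwellStefan.friction, MaxwellStefan.friction, if_neg h, if_neg h.symm, hDsymm i j h]
  obtain ⟨⟨i₁, j₁⟩, hmin⟩ := Finite.exists_min fun z : Fin n × Fin n =>
    MaxwellStefan.friction D z.1 z.2
  obtain ⟨⟨i₂, j₂⟩, hmax⟩ := Finite.exists_max fun z : Fin n × Fin n =>
    MaxwellStefan.friction D z.1 z.2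
  have hκ : ∀ i j, MaxwellStefan.friction D i₁ j₁ ≤ MaxwellStefan.friction D i j :=
    fun i j => hmin (i, j)
  have hκΛ : ∀ i j, MaxwellStefan.friction D i j ≤ MaxwellStefan.friction D i₂ j₂ :=
    fun i j => hmax (i, j)
  set Λ := MaxwellStefan.friction D i₂ j₂
  have hΛ : 0 < Λ := hfpos i₂ j₂
  obtain ⟨M₁, hM₁, hJ⟩ := MaxwellStefan.exists_flux_bound hflux
  obtain ⟨M₂, hM₂, hJbar⟩ := MaxwellStefan.exists_flux_bound hfluxbar
  -- A common bound for the fluxes and the gradients of both solutions.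
  set M := M₁ + M₂ + 2 * n * Λ * (1 * M₁) + 2 * n * Λ * (1 * M₂) with hM
  have hp₁ : 0 ≤ 2 * n * Λ * (1 * M₁) := by positivity
  have hp₂ : 0 ≤ 2 * n * Λ * (1 * M₂) := by positivity
  have hflow := hc.isBoundedFlow (fun i j => (hfpos i j).le) hκΛ (fun i => (hflux i).1) hJ
    (M' := M) (by linarith) (by linarith)
  have hflowbar := hcbar.isBoundedFlow (fun i j => (hfpos i j).le) hκΛ (fun i => (hfluxbar i).1)
    hJbar (M' := M) (by linarith) (by linarith)
  obtain ⟨δ, hδ, C, hC, hrate⟩ := MaxwellStefan.exists_energyRate_bound (hfpos i₁ j₁) hκ hκΛ hfsymm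
    (M := M) (by positivity)
  have hb := ae_all_iff.2 hc.bounds
  have hbbar := ae_all_iff.2 hcbar.bounds
  set F : MaxwellStefan.Torus3 × ℝ → ℝ := fun p => ∑ i, (c i p - cbar i p) ^ 2 / (cbar i p + δ)
    with hF
  have hFm : AEStronglyMeasurable F MaxwellStefan.stMeasure :=
    (Finset.aemeasurable_fun_sum _ fun i _ => (((hc.measurable i).aemeasurable.sub
      (hcbar.measurable i).aemeasurable).pow_const 2).div
      ((hcbar.measurable i).aemeasurable.add_const δ)).aestronglyMeasurable
  have hterm : ∀ᵐ p ∂MaxwellStefan.stMeasure, ∀ i,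
      0 ≤ (c i p - cbar i p) ^ 2 / (cbar i p + δ) := by
    filter_upwards [hbbar] with p hp i
    have := (hp i).1
    positivity
  have hF0 : ∀ᵐ p ∂MaxwellStefan.stMeasure, 0 ≤ F p :=
    hterm.mono fun p hp => Finset.sum_nonneg fun i _ => hp i
  have hFB : ∀ᵐ p ∂MaxwellStefan.stMeasure, F p ≤ n * (1 / δ) := by
    filter_upwards [hb, hbbar] with p h1 h2
    refine (Finset.sum_le_sum fun i _ => (le_abs_self _).trans (MaxwellStefan.abs_sq_div_le hδ
      (h1 i).1 (h1 i).2 (h2 i).1 (h2 i).2)).trans_eq ?_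
    simp
  -- The pointwise estimate holds for each of the three space directions, hence the factor 3. It is
  -- multiplied by `θ ≥ 0` and inserted into the energy identity summed over the species.
  have hgron : MaxwellStefan.SatisfiesGronwall (3 * C) F := by
    intro θ θ' a b hθ hθ'c hθ0 ha hz hz'
    have key := fun i => MaxwellStefan.integral_energy_eq_zero (hflow i) (hflowbar i) hδ hθ hθ'c ha
      hz hz'
    have hs := Finset.sum_congr (rfl : (Finset.univ : Finset (Fin n)) = _) fun i _ => (key i).2.2
    rw [Finset.sum_const_zero, Finset.sum_add_distrib,
      ← integral_finsetSum _ fun i _ => (key i).1, ← integral_finsetSum _ fun i _ => (key i).2.1,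
      ← integral_add (integrable_finsetSum _ fun i _ => (key i).1)
        (integrable_finsetSum _ fun i _ => (key i).2.1)] at hs
    rw [← hs]
    refine integral_mono_ae ((integrable_finsetSum _ fun i _ => (key i).1).add
      (integrable_finsetSum _ fun i _ => (key i).2.1)) ?_ ?_
    · have cθ : Continuous θ := continuous_iff_continuousAt.2 fun t => (hθ t).continuousAt
      have hcs : Continuous fun t => θ' t + 3 * C * θ t := by fun_prop
      have hz2 : ∀ t ∉ Set.Icc a b, θ' t + 3 * C * θ t = 0 := fun t ht => by
        rw [hz t ht, hz' t ht, mul_zero, add_zero]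
      obtain ⟨B, hB⟩ := (HasCompactSupport.intro isCompact_Icc hz2).exists_bound_of_continuous hcs
      refine MaxwellStefan.integrable_stMeasure_of_slab (a := a) (b := b) (C := B * (n * (1 / δ)))
        ((hcs.comp continuous_snd).aestronglyMeasurable.mul hFm) ?_ fun p hp => by
          rw [hz2 _ hp, zero_mul]
      filter_upwards [hF0, hFB] with p h1 h2
      rw [abs_mul, abs_of_nonneg h1]
      exact mul_le_mul (hB _) h2 h1 ((abs_nonneg _).trans (hB 0))
    · filter_upwards [hb, hbbar, hcbar.sum_eq_one, hc.sum_flux, hcbar.sum_flux,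
        ae_all_iff.2 fun i => ae_all_iff.2 (hflow i).flux_le,
        ae_all_iff.2 fun i => ae_all_iff.2 (hflowbar i).flux_le] with p h1 h2 h3 h4 h5 h6 h7
      have hk : ∀ k : Fin 3, ∑ i, MaxwellStefan.energyRate δ (c i p) (cbar i p)
          (MaxwellStefan.flux c u i p k) (MaxwellStefan.flux cbar ubar i p k)
          (MaxwellStefan.force D c u i p k) (MaxwellStefan.force D cbar ubar i p k) ≤ C * F p := by
        intro k
        simp only [MaxwellStefan.force_apply]
        refine hrate _ _ _ _ (fun i => (h1 i).1) (fun i => (h1 i).2) (fun i => (h2 i).1)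
          (fun i => (h2 i).2) h3 (fun i => h6 i k) (fun i => h7 i k) ?_ ?_
        · simpa using congrArg (fun v : MaxwellStefan.E3 => v k) h4
        · simpa using congrArg (fun v : MaxwellStefan.E3 => v k) h5
      have hsum := Finset.sum_le_sum fun k (_ : k ∈ (Finset.univ : Finset (Fin 3))) => hk k
      rw [Finset.sum_comm, Finset.sum_const, Finset.card_univ, Fintype.card_fin, nsmul_eq_mul] at hsum
      rw [← Finset.mul_sum, ← Finset.mul_sum, add_mul]
      refine add_le_add le_rfl ?_
      calc _ ≤ θ p.2 * ((3 : ℕ) * (C * F p)) := mul_le_mul_of_nonneg_left hsum (hθ0 _)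
        _ = _ := by push_cast; ring
  have hzero := MaxwellStefan.ae_eq_zero_of_gronwall hFm hF0 hFB (by positivity) hgron
    fun η hη => MaxwellStefan.energy_initial_small hc₀ hc hcbar hδ hη
  filter_upwards [hzero, hterm, hbbar] with p hp hnn h2
  have h1 := (Finset.sum_eq_zero_iff_of_nonneg fun i _ => hnn i).1 hp i₀ (Finset.mem_univ _)
  have h3 : cbar i₀ p + δ ≠ 0 := (add_pos_of_nonneg_of_pos (h2 i₀).1 hδ).ne'
  have h4 := (div_eq_zero_iff.1 h1).resolve_right h3
  exact sub_eq_zero.1 (pow_eq_zero_iff two_ne_zero |>.1 h4)
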